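/- Let $A\in\mathbb Z^{m\times n}$ with rows $a_1,\dots,a_m$, let $b\in\mathbb Z^m$, and suppose that $P=\{x\in\mathbb R^n: Ax\le b\}$ is a $d$-dimensional $(0,k)$-lattice polytope, i.e. the convex hull of finitely many integral points, contained in $[0,k]^n$. Let $\|A\|_\infty$ denote the largest absolute value of an entry of $A$. Let $c\in\mathbb R^n$ and consider the LP $\max\{c^{\top}x: x\in P\}$ with an initial vertex $x^0$ of $P$. A starting basis at $x^0$ is a set $B$ of $n$ linearly independent rows of $A$ that are tight at $x^0$ and of which exactly $d$ are not constant on $P$ (for $d=n$ the last condition holds automatically). Put $w=-\sum_{a\in B}a$. The lattice shadow edge-pivot rule moves from a vertex $x^i$ that is not optimal to a vertex $$x^{i+1}\in\operatorname*{arg\,max}_{u\in N_w(x^i)}\frac{c^{\top}(u-x^i)}{w^{\top}(u-x^i)},$$ where $N_w(x)$ is the set of neighbors $u$ of $x$ in the graph of $P$ with $w^{\top}u>w^{\top}x$. The Simplex method with the lattice shadow pivot rule starts at the feasible basis $B$. At a feasible basis $B'$ ($n$ linearly independent tight rows) let $z_i$, for $a_i\in B'$, be the direction with $a_i^{\top}z_i=-1$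 and $a_l^{\top}z_i=0$ for all other $a_l\in B'$. If $c^{\top}z_i\le0$ for all $i$, then the method stops. Otherwise it makes a pivot along a direction $z_i$ that maximizes $c^{\top}z_i/w^{\top}z_i$ among those with $w^{\top}z_i>0$: the row $a_i$ leaves, and a row that first becomes tight along $z_i$ enters. A pivot is non-degenerate if it changes the vertex. Then the following hold. 1. Every vertex $x^0$ of $P$ has a starting basis. For every $c$, every vertex $x^0$ and every starting basis $B$ at $x^0$: (a) however ties are broken, the edge-pivot rule follows a $c$-monotone path in the graph of $P$ from $x^0$ to an optimal vertex, in at most $dnk\|A\|_\infty$ steps; (b) however ties are broken, the Simplex method with the lattice shadow pivot rule visits only feasible bases, always has a pivot (along a $c$-improving direction) unless it stops, makes at most $dnk\|A\|_\infty$ non-degenerate pivots, each of which is a step of the edge-pivot rule, and is at an optimal vertex if it stops; (c) ties can be broken by a rule for which the Simplex method stops after finitely many pivots. 2. The monotone diameter of $P$ (the maximum, over all linear objectives $c$ that are not constant on any edge of $P$ and over all vertices $v$ of $P$, of the length of a shortest $c$-monotone path in the graph of $P$ from $v$ to the $c$-maximal vertex) is at most $dnk\|A\|_\infty$. In particular,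 it is at most $d^2k\|A\|_\infty$ if $n=d$. More generally, if a projection onto $d$ of the coordinates maps $P$ onto a $d$-dimensional polytope $\{y\in\mathbb R^d: A'y\le b'\}$ with $A'$ and $b'$ integral, then the monotone diameter of $P$ is at most $d^2k\|A'\|_\infty$. -/

import Mathlib

open scoped Matrix

noncomputable section

/-! ### Polyhedra given by integral data -/

/-- The `i`-th row of an integral matrix, as a real vector. -/
def realRow {m n : ℕ} (A : Matrix (Fin m) (Fin n) ℤ) (i : Fin m) : Fin n → ℝ :=
  fun j => (A i j : ℝ)

/-- The polyhedron `{x : A x ≤ b}`. -/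
def polyhedron {m n : ℕ} (A : Matrix (Fin m) (Fin n) ℤ) (b : Fin m → ℤ) : Set (Fin n → ℝ) :=
  {x | ∀ i, realRow A i ⬝ᵥ x ≤ (b i : ℝ)}

/-- The largest absolute value of an entry of `A` (zero if there are no entries). -/
def entryNorm {m n : ℕ} (A : Matrix (Fin m) (Fin n) ℤ) : ℕ :=
  Finset.univ.sup fun p : Fin m × Fin n => (A p.1 p.2).natAbs

/-- A `(0,k)`-lattice polytope: the convex hull of finitely many integral points,
contained in the cube `[0,k]^n`. -/
def IsLatticePolytope {n : ℕ} (k : ℕ) (P : Set (Fin n → ℝ)) : Prop :=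
  (∃ V : Finset (Fin n → ℤ),
      P = convexHull ℝ ((fun v : Fin n → ℤ => fun j => (v j : ℝ)) '' (V : Set (Fin n → ℤ)))) ∧
    ∀ x ∈ P, ∀ j, 0 ≤ x j ∧ x j ≤ (k : ℝ)

/-- The dimension of a (nonempty) polytope, that is, of its affine hull. -/
def polyDim {n : ℕ} (P : Set (Fin n → ℝ)) : ℕ :=
  Module.finrank ℝ (vectorSpan ℝ P)

/-! ### The graph of a polytope and its monotone diameter -/

/-- Two vertices are neighbours if the segment between them is a face (an edge) of `P`. -/
def Neighbor {n : ℕ} (P : Set (Fin n → ℝ)) (u v : Fin n → ℝ) : Prop :=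
  u ∈ P.extremePoints ℝ ∧ v ∈ P.extremePoints ℝ ∧ u ≠ v ∧ IsExtreme ℝ P (segment ℝ u v)

/-- `x` is an optimal solution of the linear program `max {c · y : y ∈ P}`. -/
def IsOptimal {n : ℕ} (P : Set (Fin n → ℝ)) (c x : Fin n → ℝ) : Prop :=
  x ∈ P ∧ ∀ y ∈ P, c ⬝ᵥ y ≤ c ⬝ᵥ x

/-- An objective is generic if it orients every edge of `P`. -/
def IsGenericObjective {n : ℕ} (P : Set (Fin n → ℝ)) (c : Fin n → ℝ) : Prop :=
  ∀ u v, Neighbor P u v → c ⬝ᵥ u ≠ c ⬝ᵥ v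

/-- `p 0, …, p L` is a path in the graph of `P` along which `c` strictly increases. -/
def IsMonotonePath {n : ℕ} (P : Set (Fin n → ℝ)) (c : Fin n → ℝ) (L : ℕ)
    (p : ℕ → Fin n → ℝ) : Prop :=
  ∀ s < L, Neighbor P (p s) (p (s + 1)) ∧ c ⬝ᵥ p s < c ⬝ᵥ p (s + 1)

/-- The length of a shortest `c`-monotone path from `v` to a `c`-maximal vertex
(infinite if there is none). -/
def monotoneDist {n : ℕ} (P : Set (Fin n → ℝ)) (c v : Fin n → ℝ) : ℕ∞ :=
  ⨅ (L : ℕ) (_ : ∃ p : ℕ → Fin n → ℝ,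
    p 0 = v ∧ IsMonotonePath P c L p ∧ IsOptimal P c (p L)), (L : ℕ∞)

/-- The monotone diameter: the largest distance of a vertex to the sink in the directed graph of
`P`, over all orientations induced by generic linear objectives. -/
def monotoneDiameter {n : ℕ} (P : Set (Fin n → ℝ)) : ℕ∞ :=
  ⨆ (c : Fin n → ℝ) (_ : IsGenericObjective P c) (v : Fin n → ℝ) (_ : v ∈ P.extremePoints ℝ),
    monotoneDist P c v

/-! ### The shadow edge-pivot rule with auxiliary vector `w` -/

/-- The `w`-improving neighbours of `x`. -/
def improvingNeighbors {n : ℕ} (P : Set (Fin n → ℝ)) (w x : Fin n → ℝ) : Set (Fin n → ℝ) :=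
  {u | Neighbor P x u ∧ w ⬝ᵥ x < w ⬝ᵥ u}

/-- `u` is an element of the argmax of `c · (u - x) / w · (u - x)` over the `w`-improving
neighbours `u` of `x`. -/
def IsShadowStep {n : ℕ} (P : Set (Fin n → ℝ)) (c w x u : Fin n → ℝ) : Prop :=
  u ∈ improvingNeighbors P w x ∧ ∀ u' ∈ improvingNeighbors P w x,
    (c ⬝ᵥ (u' - x)) / (w ⬝ᵥ (u' - x)) ≤ (c ⬝ᵥ (u - x)) / (w ⬝ᵥ (u - x))

/-- `x 0, …, x T` is produced by the shadow edge-pivot rule, which stops at an optimum. -/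
def IsShadowRun {n : ℕ} (P : Set (Fin n → ℝ)) (c w : Fin n → ℝ) (T : ℕ)
    (x : ℕ → Fin n → ℝ) : Prop :=
  ∀ s < T, ¬ IsOptimal P c (x s) ∧ IsShadowStep P c w (x s) (x (s + 1))

/-! ### Bases, and the choice of the auxiliary vector in the lattice shadow rule -/

/-- `B` is a feasible basis with basic solution `x`: `n` linearly independent rows (so a maximal
linearly independent set of rows) that are tight at the point `x` of `{x : A x ≤ b}`. -/
structure IsTightBasis {m n : ℕ} (A : Matrix (Fin m) (Fin n) ℤ) (b : Fin m → ℤ)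
    (B : Finset (Fin m)) (x : Fin n → ℝ) : Prop where
  feasible : x ∈ polyhedron A b
  tight : ∀ i ∈ B, realRow A i ⬝ᵥ x = (b i : ℝ)
  indep : LinearIndependent ℝ (fun i : B => realRow A i)
  card_eq : B.card = n

/-- The bases from which the lattice shadow rule may start. Let `d` be the dimension of
`P = {x : A x ≤ b}`. If `d < n`, some inequalities of the system hold with equality on all of `P`;
these do not give facet directions. The basis contains `n - d` of them, and so exactly `d` rows
that are not constant on `P`. If `d = n`, then every tight basis has this property. -/
def IsLatticeStart {m n : ℕ} (A : Matrix (Fin m) (Fin n) ℤ) (b : Fin m → ℤ)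
    (B : Finset (Fin m)) (x : Fin n → ℝ) : Prop :=
  IsTightBasis A b B x ∧
    {i | i ∈ B ∧ ∃ y ∈ polyhedron A b, realRow A i ⬝ᵥ y < (b i : ℝ)}.ncard =
      polyDim (polyhedron A b)

/-- The auxiliary vector of the lattice shadow rule: minus the sum of the rows in `B`. The rows
of `B` that are constant on `P` do not affect differences `w · (u - x)` with `u, x ∈ P`. -/
def auxVector {m n : ℕ} (A : Matrix (Fin m) (Fin n) ℤ) (B : Finset (Fin m)) : Fin n → ℝ :=
  -∑ i ∈ B, realRow A i

/-! ### The Simplex method on bases -/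

/-- `z` is the direction in which the inequality `i ∈ B` is relaxed while all other inequalities
of the basis `B` remain tight. -/
def IsBasicDirection {m n : ℕ} (A : Matrix (Fin m) (Fin n) ℤ) (B : Finset (Fin m)) (i : Fin m)
    (z : Fin n → ℝ) : Prop :=
  i ∈ B ∧ realRow A i ⬝ᵥ z = -1 ∧ ∀ l ∈ B, l ≠ i → realRow A l ⬝ᵥ z = 0

/-- The stopping criterion of the Simplex method: no basic direction improves `c`. -/
def IsOptimalBasis {m n : ℕ} (A : Matrix (Fin m) (Fin n) ℤ) (c : Fin n → ℝ)
    (B : Finset (Fin m)) : Prop :=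
  ∀ i z, IsBasicDirection A B i z → c ⬝ᵥ z ≤ 0

/-- A pivot of the Simplex method for `max {c · x : A x ≤ b}` from the basis `S.1` with basic
solution `S.2` to the basis `S'.1` with basic solution `S'.2`. A row `i` whose basic direction `z`
improves `c` leaves the basis, and a row `j` that is first to become tight along `z` enters it.
The pivot is degenerate if the step length is zero, that is, if `S'.2 = S.2`. -/
def IsSimplexPivot {m n : ℕ} (A : Matrix (Fin m) (Fin n) ℤ) (b : Fin m → ℤ) (c : Fin n → ℝ)
    (i : Fin m) (z : Fin n → ℝ) (S S' : Finset (Fin m) × (Fin n → ℝ)) : Prop :=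
  IsBasicDirection A S.1 i z ∧ 0 < c ⬝ᵥ z ∧
    ∃ j, 0 < realRow A j ⬝ᵥ z ∧
      (∀ l, 0 < realRow A l ⬝ᵥ z →
        ((b j : ℝ) - realRow A j ⬝ᵥ S.2) / (realRow A j ⬝ᵥ z) ≤
          ((b l : ℝ) - realRow A l ⬝ᵥ S.2) / (realRow A l ⬝ᵥ z)) ∧
      S'.1 = insert j (S.1.erase i) ∧
      S'.2 = S.2 + (((b j : ℝ) - realRow A j ⬝ᵥ S.2) / (realRow A j ⬝ᵥ z)) • z

/-- A pivot chosen by the shadow pivot rule with auxiliary vector `w`: among the basic directions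
that improve `w`, the chosen one maximizes the ratio `c · z / w · z`. -/
def IsShadowPivot {m n : ℕ} (A : Matrix (Fin m) (Fin n) ℤ) (b : Fin m → ℤ) (c w : Fin n → ℝ)
    (S S' : Finset (Fin m) × (Fin n → ℝ)) : Prop :=
  ∃ i z, IsSimplexPivot A b c i z S S' ∧ 0 < w ⬝ᵥ z ∧
    ∀ i' z', IsBasicDirection A S.1 i' z' → 0 < w ⬝ᵥ z' →
      (c ⬝ᵥ z') / (w ⬝ᵥ z') ≤ (c ⬝ᵥ z) / (w ⬝ᵥ z)

/-- `S 0, …, S T` is produced by the Simplex method with the shadow pivot rule, which stops at an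
optimal basis. Ties are broken arbitrarily. -/
def IsSimplexRun {m n : ℕ} (A : Matrix (Fin m) (Fin n) ℤ) (b : Fin m → ℤ) (c w : Fin n → ℝ)
    (T : ℕ) (S : ℕ → Finset (Fin m) × (Fin n → ℝ)) : Prop :=
  ∀ s < T, ¬ IsOptimalBasis A c (S s).1 ∧ IsShadowPivot A b c w (S s) (S (s + 1))

/-- The number of non-degenerate pivots among the first `T` pivots. -/
def nondegenerateSteps {m n : ℕ} (T : ℕ) (S : ℕ → Finset (Fin m) × (Fin n → ℝ)) : ℕ :=
  {s : ℕ | s < T ∧ (S (s + 1)).2 ≠ (S s).2}.ncard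

end

/-! ### Linear algebra of tight bases -/

section

variable {m n : ℕ} {A : Matrix (Fin m) (Fin n) ℤ} {b : Fin m → ℤ}

/-! The length bound comes from counting with `w`. It is an integral vector and the vertices are
integral, so every step that increases `w` increases it by at least 1
(`auxVector_dotProduct_add_one_le`). Over `P` it can rise above its value at the start by at most `d
* n * k * entryNorm A`: the rows of `B` that are constant on `P` cancel, and each of the other `d`
contributes at most `n * k * entryNorm A` (`auxVector_dotProduct_sub_le`).

Progress comes from a parametric invariant: the current vertex maximizes `c - lam • w` for some `lam
≥ 0`. It holds at the start because `w` grows at rate 1 along every basic direction of `B`, so a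
large `lam` makes `B` dual feasible. If the invariant holds, a `c`-improving edge is also
`w`-improving, and the steepest slope `mu` satisfies `0 < mu ≤ lam`; both ends of the chosen edge
then maximize `c - mu • w` (`IsShadowStep.improves`). The Simplex method carries the same invariant
as dual feasibility of the basis (`IsShadowBasis.pivot`), and its non-degenerate pivots are edge
steps.

Cycling is excluded by an infinitesimal generic perturbation of the right-hand side that keeps the
starting basis feasible: with the lexicographic ratio test the perturbed value of `w` strictly
increases (`IsShadowBasis.exists_lex_pivot`). The diameter bounds follow from the edge rule, applied
in the last case to the projected polytope, which is affinely isomorphic to `P`. -/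

theorem exists_dotProduct_eq_of_linearIndependent {ι : Type*} [Fintype ι] {v : ι → Fin n → ℝ}
    (hv : LinearIndependent ℝ v) (r : ι → ℝ) : ∃ z : Fin n → ℝ, ∀ i, v i ⬝ᵥ z = r i := by
  classical
  have hrank := LinearIndependent.rank_matrix (M := Matrix.of v) hv
  have htop : LinearMap.range (Matrix.of v).mulVecLin = ⊤ := by
    apply Submodule.eq_top_of_finrank_eq
    rw [Module.finrank_fintype_fun_eq_card]
    exact hrank
  obtain ⟨z, hz⟩ := LinearMap.range_eq_top.1 htop r
  exact ⟨z, fun i => congrFun hz i⟩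

theorem dotProduct_eq_zero_of_mem_span_realRow {s : Set (Fin m)} {z v : Fin n → ℝ}
    (hz : ∀ i ∈ s, realRow A i ⬝ᵥ z = 0) (hv : v ∈ Submodule.span ℝ (realRow A '' s)) :
    v ⬝ᵥ z = 0 := by
  induction hv using Submodule.span_induction with
  | mem v hv =>
    obtain ⟨i, hi, rfl⟩ := hv
    exact hz i hi
  | zero => simp
  | add u v _ _ hu hv => rw [add_dotProduct, hu, hv, add_zero]
  | smul a v _ hv => rw [smul_dotProduct, hv, smul_zero]

theorem eq_zero_of_dotProduct_eq_zero_of_span_eq_top {s : Set (Fin n → ℝ)}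
    (hs : Submodule.span ℝ s = ⊤) {z : Fin n → ℝ} (hz : ∀ v ∈ s, v ⬝ᵥ z = 0) : z = 0 := by
  have : ∀ v ∈ Submodule.span ℝ s, v ⬝ᵥ z = 0 := by
    intro v hv
    induction hv using Submodule.span_induction with
    | mem v hv => exact hz v hv
    | zero => simp
    | add u v _ _ hu hv => rw [add_dotProduct, hu, hv, add_zero]
    | smul a v _ hv => rw [smul_dotProduct, hv, smul_zero]
  exact dotProduct_self_eq_zero.1 (this z (hs ▸ Submodule.mem_top))

section Basis

variable {B : Finset (Fin m)}

theorem exists_realRow_dotProduct_eq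
    (hB : LinearIndependent ℝ (fun i : B => realRow A i)) (r : Fin m → ℝ) :
    ∃ z : Fin n → ℝ, ∀ i ∈ B, realRow A i ⬝ᵥ z = r i := by
  obtain ⟨z, hz⟩ := exists_dotProduct_eq_of_linearIndependent hB (fun i => r i)
  exact ⟨z, fun i hi => hz ⟨i, hi⟩⟩

theorem span_realRow_eq_top
    (hB : LinearIndependent ℝ (fun i : B => realRow A i)) (hcard : B.card = n) :
    Submodule.span ℝ (Set.range (fun i : B => realRow A i)) = ⊤ :=
  hB.span_eq_top_of_card_eq_finrank' (by simp [hcard])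

theorem eq_zero_of_realRow_dotProduct_eq_zero
    (hB : LinearIndependent ℝ (fun i : B => realRow A i)) (hcard : B.card = n) {z : Fin n → ℝ}
    (hz : ∀ i ∈ B, realRow A i ⬝ᵥ z = 0) : z = 0 := by
  refine eq_zero_of_dotProduct_eq_zero_of_span_eq_top (span_realRow_eq_top hB hcard) ?_
  rintro _ ⟨i, rfl⟩
  exact hz i i.2

theorem exists_isBasicDirection
    (hB : LinearIndependent ℝ (fun i : B => realRow A i)) {i : Fin m} (hi : i ∈ B) : ∃ z, IsBasicDirection A B i z := by
  obtain ⟨z, hz⟩ := exists_realRow_dotProduct_eq hB (fun l => if l = i then -1 else 0)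
  refine ⟨z, hi, by simp [hz i hi], fun l hl hne => by simp [hz l hl, hne]⟩

theorem exists_forall_isBasicDirection
    (hB : LinearIndependent ℝ (fun i : B => realRow A i)) :
    ∃ Z : Fin m → Fin n → ℝ, ∀ i, i ∈ B → IsBasicDirection A B i (Z i) := by
  have hZ : ∀ i, ∃ z, i ∈ B → IsBasicDirection A B i z := fun i => by
    by_cases hi : i ∈ B
    · obtain ⟨z, hz⟩ := exists_isBasicDirection hB hi
      exact ⟨z, fun _ => hz⟩
    · exact ⟨0, fun h => absurd h hi⟩
  exact ⟨fun i => (hZ i).choose, fun i => (hZ i).choose_spec⟩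

/-- The basic directions generate the cone cut out by the rows of `B`: `v` is their combination with
coefficients `-(realRow A i ⬝ᵥ v) ≥ 0`. -/
theorem dotProduct_nonpos_of_forall_isBasicDirection
    (hB : LinearIndependent ℝ (fun i : B => realRow A i)) (hcard : B.card = n) {h : Fin n → ℝ}
    (hh : ∀ i z, IsBasicDirection A B i z → h ⬝ᵥ z ≤ 0) {v : Fin n → ℝ}
    (hv : ∀ i ∈ B, realRow A i ⬝ᵥ v ≤ 0) : h ⬝ᵥ v ≤ 0 := by
  classical
  obtain ⟨Z, hZ⟩ := exists_forall_isBasicDirection hB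
  have hdec : v - ∑ i ∈ B, (-(realRow A i ⬝ᵥ v)) • Z i = 0 := by
    refine eq_zero_of_realRow_dotProduct_eq_zero hB hcard fun l hl => ?_
    rw [dotProduct_sub, dotProduct_sum, Finset.sum_eq_single l]
    · rw [dotProduct_smul, (hZ l hl).2.1]; simp
    · intro i hi hne
      rw [dotProduct_smul, (hZ i hi).2.2 l hl hne.symm, smul_zero]
    · exact fun h => absurd hl h
  rw [sub_eq_zero.1 hdec, dotProduct_sum]
  refine Finset.sum_nonpos fun i hi => ?_
  rw [dotProduct_smul, smul_eq_mul]
  exact mul_nonpos_of_nonneg_of_nonpos (neg_nonneg.2 (hv i hi)) (hh i _ (hZ i hi))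

/-- The rows kept from `B` all vanish on `z` and row `j` does not, so row `j` is outside their span.
-/
theorem linearIndependent_exchange
    (hB : LinearIndependent ℝ (fun i : B => realRow A i)) (hcard : B.card = n) {i j : Fin m} {z : Fin n → ℝ} (hz : IsBasicDirection A B i z)
    (hj : 0 < realRow A j ⬝ᵥ z) :
    LinearIndependent ℝ (fun l : (insert j (B.erase i) : Finset (Fin m)) => realRow A l) ∧
      (insert j (B.erase i)).card = n := by
  classical
  have hjB : j ∉ B := by
    intro hjB
    by_cases hji : j = i
    · rw [hji, hz.2.1] at hj; linarith
    · rw [hz.2.2 j hjB hji] at hj; exact lt_irrefl _ hj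
  constructor
  · have h1 : LinearIndepOn ℝ (realRow A) (↑(B.erase i) : Set (Fin m)) :=
      LinearIndepOn.mono (show LinearIndepOn ℝ (realRow A) (↑B : Set (Fin m)) from hB)
        (by exact_mod_cast Finset.erase_subset i B)
    have h2 : LinearIndepOn ℝ (realRow A) (insert j (↑(B.erase i) : Set (Fin m))) := by
      refine h1.insert fun hmem => ?_
      refine hj.ne' (dotProduct_eq_zero_of_mem_span_realRow (fun l hl => ?_) hmem)
      have hl := Finset.mem_erase.1 (Finset.mem_coe.1 hl)
      exact hz.2.2 l hl.2 hl.1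
    rw [← Finset.coe_insert] at h2
    exact h2
  · rw [Finset.card_insert_of_notMem (fun h => hjB (Finset.mem_of_mem_erase h)),
      Finset.card_erase_of_mem hz.1, hcard]
    have : 0 < B.card := Finset.card_pos.2 ⟨i, hz.1⟩
    omega

/-- Exchanging a row whose basic direction is `h`-neutral preserves dual feasibility for `h`. -/
theorem forall_isBasicDirection_exchange
    (hB : LinearIndependent ℝ (fun i : B => realRow A i)) (hcard : B.card = n) {i j : Fin m} {z h : Fin n → ℝ}
    (hz : IsBasicDirection A B i z)
    (hh : ∀ i z, IsBasicDirection A B i z → h ⬝ᵥ z ≤ 0) (hhz : h ⬝ᵥ z = 0) :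
    ∀ i' z', IsBasicDirection A (insert j (B.erase i)) i' z' → h ⬝ᵥ z' ≤ 0 := by
  classical
  intro i' z' hz'
  have hle : ∀ l ∈ B, l ≠ i → realRow A l ⬝ᵥ z' ≤ 0 := by
    intro l hl hli
    have hmem : l ∈ insert j (B.erase i) :=
      Finset.mem_insert_of_mem (Finset.mem_erase.2 ⟨hli, hl⟩)
    by_cases hli' : l = i'
    · rw [hli', hz'.2.1]; norm_num
    · exact (hz'.2.2 l hmem hli').le
  -- Since row `i` is `-1` on `z`, this shift of `z'` makes row `i` vanish and puts the vector in
  -- the cone of `B`; `h` does not see the shift.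
  have key : h ⬝ᵥ (z' + (realRow A i ⬝ᵥ z') • z) ≤ 0 := by
    refine dotProduct_nonpos_of_forall_isBasicDirection hB hcard hh fun l hl => ?_
    rw [dotProduct_add, dotProduct_smul, smul_eq_mul]
    by_cases hli : l = i
    · rw [hli, hz.2.1]; linarith
    · rw [hz.2.2 l hl hli]; linarith [hle l hl hli]
  rw [dotProduct_add, dotProduct_smul, hhz, smul_zero, add_zero] at key
  exact key

end Basis

/-- The auxiliary vector of `B` increases at unit rate along every basic direction of `B`. -/
theorem auxVector_dotProduct_of_isBasicDirection {B : Finset (Fin m)} {i : Fin m}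
    {z : Fin n → ℝ} (hz : IsBasicDirection A B i z) : auxVector A B ⬝ᵥ z = 1 := by
  rw [auxVector, neg_dotProduct, sum_dotProduct, Finset.sum_eq_single i]
  · rw [hz.2.1]; norm_num
  · exact fun l hl hne => hz.2.2 l hl hne
  · exact fun h => absurd hz.1 h

theorem isBasicDirection_unique {B : Finset (Fin m)}
    (hB : LinearIndependent ℝ (fun i : B => realRow A i)) (hcard : B.card = n) {i : Fin m}
    {z z' : Fin n → ℝ} (hz : IsBasicDirection A B i z) (hz' : IsBasicDirection A B i z') :
    z = z' := by
  refine sub_eq_zero.1 (eq_zero_of_realRow_dotProduct_eq_zero hB hcard fun l hl => ?_)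
  rw [dotProduct_sub]
  by_cases hli : l = i
  · rw [hli, hz.2.1, hz'.2.1, sub_self]
  · rw [hz.2.2 l hl hli, hz'.2.2 l hl hli, sub_self]

theorem isOptimal_of_forall_isBasicDirection {B : Finset (Fin m)} {x h : Fin n → ℝ}
    (hB : IsTightBasis A b B x) (hh : ∀ i z, IsBasicDirection A B i z → h ⬝ᵥ z ≤ 0) :
    IsOptimal (polyhedron A b) h x := by
  refine ⟨hB.feasible, fun y hy => ?_⟩
  have := dotProduct_nonpos_of_forall_isBasicDirection hB.indep hB.card_eq hh (v := y - x)
    fun i hi => by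
      rw [dotProduct_sub, hB.tight i hi]
      linarith [hy i]
  rw [dotProduct_sub] at this
  linarith

/-- At the basis that defines the auxiliary vector, `c - lam • w` is dual feasible for large
`lam`. -/
theorem exists_dual_feasible_auxVector {B : Finset (Fin m)}
    (hB : LinearIndependent ℝ (fun i : B => realRow A i)) (hcard : B.card = n)
    (c : Fin n → ℝ) :
    ∃ lam : ℝ, 0 ≤ lam ∧
      ∀ i z, IsBasicDirection A B i z → (c - lam • auxVector A B) ⬝ᵥ z ≤ 0 := by
  classical
  obtain ⟨Z, hZ⟩ := exists_forall_isBasicDirection hB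
  -- The sum dominates each single `c ⬝ᵥ Z i`; the arbitrary values of `Z` outside `B` only enlarge
  -- it.
  refine ⟨∑ i, |c ⬝ᵥ Z i|, Finset.sum_nonneg fun i _ => abs_nonneg _, fun i z hz => ?_⟩
  rw [sub_dotProduct, smul_dotProduct, auxVector_dotProduct_of_isBasicDirection hz,
    isBasicDirection_unique hB hcard hz (hZ i hz.1), smul_eq_mul, mul_one, sub_nonpos]
  exact (le_abs_self _).trans
    (Finset.single_le_sum (f := fun i => |c ⬝ᵥ Z i|) (fun i _ => abs_nonneg _)
      (Finset.mem_univ i))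

end

/-! ### Edges of a polyhedron -/

theorem exists_minimal_ratio {m n : ℕ} (A : Matrix (Fin m) (Fin n) ℤ) (b : Fin m → ℤ)
    {x z : Fin n → ℝ} (h : ∃ j, 0 < realRow A j ⬝ᵥ z) :
    ∃ j, 0 < realRow A j ⬝ᵥ z ∧ ∀ l, 0 < realRow A l ⬝ᵥ z →
      ((b j : ℝ) - realRow A j ⬝ᵥ x) / (realRow A j ⬝ᵥ z) ≤
        ((b l : ℝ) - realRow A l ⬝ᵥ x) / (realRow A l ⬝ᵥ z) := by
  classical
  obtain ⟨j, hj, hmin⟩ := Finset.exists_min_image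
    (Finset.univ.filter fun j => 0 < realRow A j ⬝ᵥ z)
    (fun l => ((b l : ℝ) - realRow A l ⬝ᵥ x) / (realRow A l ⬝ᵥ z))
    (h.imp fun j hj => by simpa using hj)
  exact ⟨j, by simpa using hj, fun l hl => hmin l (by simpa using hl)⟩

section

variable {m n : ℕ} {A : Matrix (Fin m) (Fin n) ℤ} {b : Fin m → ℤ}

theorem ratio_test {x z : Fin n → ℝ} (hx : x ∈ polyhedron A b) {j : Fin m}
    (hj : 0 < realRow A j ⬝ᵥ z)
    (hmin : ∀ l, 0 < realRow A l ⬝ᵥ z →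
      ((b j : ℝ) - realRow A j ⬝ᵥ x) / (realRow A j ⬝ᵥ z) ≤
        ((b l : ℝ) - realRow A l ⬝ᵥ x) / (realRow A l ⬝ᵥ z)) :
    0 ≤ ((b j : ℝ) - realRow A j ⬝ᵥ x) / (realRow A j ⬝ᵥ z) ∧
      x + (((b j : ℝ) - realRow A j ⬝ᵥ x) / (realRow A j ⬝ᵥ z)) • z ∈ polyhedron A b ∧
      realRow A j ⬝ᵥ (x + (((b j : ℝ) - realRow A j ⬝ᵥ x) / (realRow A j ⬝ᵥ z)) • z) =
        (b j : ℝ) := by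
  set t := ((b j : ℝ) - realRow A j ⬝ᵥ x) / (realRow A j ⬝ᵥ z) with ht
  have h0 : 0 ≤ t := div_nonneg (sub_nonneg.2 (hx j)) hj.le
  refine ⟨h0, fun l => ?_, ?_⟩
  · rw [dotProduct_add, dotProduct_smul, smul_eq_mul]
    by_cases hl : 0 < realRow A l ⬝ᵥ z
    · have := (le_div_iff₀ hl).1 (hmin l hl)
      linarith
    · have := mul_nonpos_of_nonneg_of_nonpos h0 (not_lt.1 hl)
      linarith [hx l]
  · rw [dotProduct_add, dotProduct_smul, smul_eq_mul, ht, div_mul_cancel₀ _ hj.ne']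
    ring

theorem convex_polyhedron : Convex ℝ (polyhedron A b) := by
  intro x hx y hy s t hs ht hst i
  rw [dotProduct_add, dotProduct_smul, dotProduct_smul, smul_eq_mul, smul_eq_mul]
  have h1 := mul_le_mul_of_nonneg_left (hx i) hs
  have h2 := mul_le_mul_of_nonneg_left (hy i) ht
  have h3 : s * (b i : ℝ) + t * (b i : ℝ) = b i := by rw [← add_mul, hst, one_mul]
  linarith

theorem tight_of_mem_openSegment {p q r : Fin n → ℝ} (hp : p ∈ polyhedron A b)
    (hq : q ∈ polyhedron A b) (hr : r ∈ openSegment ℝ p q) {i : Fin m}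
    (hi : realRow A i ⬝ᵥ r = b i) : realRow A i ⬝ᵥ p = b i := by
  obtain ⟨s, t, hs, ht, hst, rfl⟩ := hr
  rw [dotProduct_add, dotProduct_smul, dotProduct_smul, smul_eq_mul, smul_eq_mul] at hi
  refine le_antisymm (hp i) (not_lt.1 fun hlt => ?_)
  have h1 := mul_lt_mul_of_pos_left hlt hs
  have h2 := mul_le_mul_of_nonneg_left (hq i) ht.le
  have h3 : s * (b i : ℝ) + t * (b i : ℝ) = b i := by rw [← add_mul, hst, one_mul]
  linarith

/-- A segment cut out of `{x : A x ≤ b}` by turning the inequalities in `F` into equations is an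
edge. -/
theorem neighbor_add_smul {x z : Fin n → ℝ} {t : ℝ} (hx : x ∈ polyhedron A b) (ht : 0 < t)
    (hu : x + t • z ∈ polyhedron A b) {F : Set (Fin m)} (hxF : ∀ i ∈ F, realRow A i ⬝ᵥ x = b i)
    (hzF : ∀ i ∈ F, realRow A i ⬝ᵥ z = 0)
    (hF : ∀ z', (∀ i ∈ F, realRow A i ⬝ᵥ z' = 0) → ∃ α : ℝ, z' = α • z)
    {i j : Fin m} (hix : realRow A i ⬝ᵥ x = b i) (hiz : realRow A i ⬝ᵥ z < 0)
    (hju : realRow A j ⬝ᵥ (x + t • z) = b j) (hjz : 0 < realRow A j ⬝ᵥ z) :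
    Neighbor (polyhedron A b) x (x + t • z) := by
  -- The face defined by `F` lies on this line; row `i` forces `0 ≤ α` and row `j` forces `α ≤ t`.
  have line : ∀ p, (∀ l ∈ F, realRow A l ⬝ᵥ p = b l) → ∃ α : ℝ, p = x + α • z := by
    intro p hp
    obtain ⟨α, hα⟩ := hF (p - x) fun l hl => by rw [dotProduct_sub, hp l hl, hxF l hl, sub_self]
    exact ⟨α, by rw [← hα]; abel⟩
  have tightF : ∀ α : ℝ, ∀ l ∈ F, realRow A l ⬝ᵥ (x + α • z) = b l := fun α l hl => by
    rw [dotProduct_add, dotProduct_smul, hzF l hl, smul_zero, add_zero, hxF l hl]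
  have hlow : ∀ α : ℝ, x + α • z ∈ polyhedron A b → 0 ≤ α := by
    intro α hα
    have := hα i
    rw [dotProduct_add, dotProduct_smul, hix, smul_eq_mul] at this
    exact not_lt.1 fun hlt => by nlinarith [mul_pos_of_neg_of_neg hlt hiz]
  have hupp : ∀ α : ℝ, x + α • z ∈ polyhedron A b → α ≤ t := by
    intro α hα
    have h1 := hα j
    rw [← hju, dotProduct_add, dotProduct_add, dotProduct_smul, dotProduct_smul, smul_eq_mul,
      smul_eq_mul] at h1
    exact le_of_mul_le_mul_right (by linarith) hjz
  have hxlow : ∀ p ∈ polyhedron A b, ∀ q ∈ polyhedron A b, x ∈ openSegment ℝ p q → p = x := by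
    intro p hp q hq hr
    obtain ⟨α, rfl⟩ := line p fun l hl => tight_of_mem_openSegment hp hq hr (hxF l hl)
    have h1 := tight_of_mem_openSegment hp hq hr hix
    rw [dotProduct_add, dotProduct_smul, hix, smul_eq_mul, add_eq_left] at h1
    rcases mul_eq_zero.1 h1 with h | h
    · simp [h]
    · exact absurd h hiz.ne
  have hulow : ∀ p ∈ polyhedron A b, ∀ q ∈ polyhedron A b, x + t • z ∈ openSegment ℝ p q →
      p = x + t • z := by
    intro p hp q hq hr
    obtain ⟨α, rfl⟩ := line p fun l hl => tight_of_mem_openSegment hp hq hr (tightF t l hl)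
    have h1 := tight_of_mem_openSegment hp hq hr hju
    rw [← hju, dotProduct_add, dotProduct_add, dotProduct_smul, dotProduct_smul, smul_eq_mul,
      smul_eq_mul, add_right_inj] at h1
    rw [mul_right_cancel₀ hjz.ne' h1]
  refine ⟨mem_extremePoints.2 ⟨hx, fun p hp q hq hr => ⟨hxlow p hp q hq hr,
      hxlow q hq p hp (openSegment_symm ℝ p q ▸ hr)⟩⟩,
    mem_extremePoints.2 ⟨hu, fun p hp q hq hr => ⟨hulow p hp q hq hr,
      hulow q hq p hp (openSegment_symm ℝ p q ▸ hr)⟩⟩, ?_, ?_⟩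
  · intro h
    have h1 := hju
    rw [← h] at h1
    rw [dotProduct_add, dotProduct_smul, h1, smul_eq_mul, add_eq_left] at hju
    exact (mul_pos ht hjz).ne' hju
  · refine ⟨convex_polyhedron.segment_subset hx hu, fun p hp q hq r hr hrpq => ?_⟩
    have hrF : ∀ l ∈ F, realRow A l ⬝ᵥ r = b l := by
      rw [segment_eq_image'] at hr
      obtain ⟨θ, -, rfl⟩ := hr
      intro l hl
      dsimp only
      rw [add_sub_cancel_left, smul_smul]
      exact tightF _ l hl
    obtain ⟨α, rfl⟩ := line p fun l hl => tight_of_mem_openSegment hp hq hrpq (hrF l hl)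
    rw [segment_eq_image']
    refine ⟨α / t, ⟨div_nonneg (hlow α hp) ht.le, (div_le_one ht).2 (hupp α hp)⟩, ?_⟩
    dsimp only
    rw [add_sub_cancel_left, smul_smul, div_mul_cancel₀ _ ht.ne']

/-! ### Feasible directions, extreme rays and local optimality. -/

theorem exists_add_smul_mem_polyhedron {x z : Fin n → ℝ} (hx : x ∈ polyhedron A b)
    (hz : ∀ i, realRow A i ⬝ᵥ x = b i → realRow A i ⬝ᵥ z ≤ 0) :
    ∃ ε : ℝ, 0 < ε ∧ x + ε • z ∈ polyhedron A b := by
  by_cases h : ∃ j, 0 < realRow A j ⬝ᵥ z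
  · obtain ⟨j, hj, hmin⟩ := exists_minimal_ratio A b (x := x) h
    obtain ⟨-, h2, -⟩ := ratio_test hx hj hmin
    refine ⟨_, div_pos (sub_pos.2 (lt_of_le_of_ne (hx j) fun h => ?_)) hj, h2⟩
    exact absurd hj (not_lt.2 (hz j h))
  · refine ⟨1, one_pos, fun i => ?_⟩
    rw [dotProduct_add, one_smul]
    linarith [hx i, not_lt.1 fun hi => h ⟨i, hi⟩]

/-- The rows tight at an extreme point separate directions. -/
theorem eq_zero_of_tight_of_mem_extremePoints {x : Fin n → ℝ}
    (hx : x ∈ (polyhedron A b).extremePoints ℝ) {z : Fin n → ℝ}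
    (hz : ∀ i, realRow A i ⬝ᵥ x = b i → realRow A i ⬝ᵥ z = 0) : z = 0 := by
  rw [mem_extremePoints] at hx
  obtain ⟨s, hs, hs'⟩ := exists_add_smul_mem_polyhedron hx.1 fun i hi => (hz i hi).le
  obtain ⟨t, ht, ht'⟩ := exists_add_smul_mem_polyhedron (z := -z) hx.1 fun i hi => by
    rw [dotProduct_neg, hz i hi, neg_zero]
  have hmem : x ∈ openSegment ℝ (x + s • z) (x + t • -z) := by
    have hst : 0 < s + t := add_pos hs ht
    refine ⟨t / (s + t), s / (s + t), div_pos ht hst, div_pos hs hst, ?_, ?_⟩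
    · rw [← add_div, add_comm, div_self hst.ne']
    · ext i
      simp only [Pi.add_apply, Pi.smul_apply, Pi.neg_apply, smul_eq_mul]
      field_simp
      ring
  have h := (hx.2 _ hs' _ ht' hmem).1
  rw [add_eq_left] at h
  exact (smul_eq_zero.1 h).resolve_left hs.ne'

theorem exists_realRow_dotProduct_pos {k : ℕ}
    (hbd : ∀ x ∈ polyhedron A b, ∀ j, 0 ≤ x j ∧ x j ≤ (k : ℝ)) {x : Fin n → ℝ}
    (hx : x ∈ polyhedron A b) {z : Fin n → ℝ} (hz : z ≠ 0) : ∃ j, 0 < realRow A j ⬝ᵥ z := by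
  by_contra! h
  have hray : ∀ s : ℝ, 0 ≤ s → x + s • z ∈ polyhedron A b := by
    intro s hs i
    rw [dotProduct_add, dotProduct_smul, smul_eq_mul]
    linarith [hx i, mul_nonpos_of_nonneg_of_nonpos hs (h i)]
  obtain ⟨j, hj⟩ : ∃ j, z j ≠ 0 := by
    by_contra! h0
    exact hz (funext h0)
  -- This step length moves coordinate `j` by `k + 1`, more than the width of the cube.
  have h1 := hbd _ (hray ((k + 1) / |z j|) (by positivity)) j
  have h2 := hbd x hx j
  have h3 : (x + ((k + 1) / |z j|) • z) j = x j + (k + 1) * (z j / |z j|) := by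
    simp only [Pi.add_apply, Pi.smul_apply, smul_eq_mul]
    ring
  rw [h3] at h1
  rcases lt_or_gt_of_ne hj with hneg | hpos
  · rw [abs_of_neg hneg, div_neg, div_self hj] at h1
    linarith [h1.1]
  · rw [abs_of_pos hpos, div_self hj] at h1
    linarith [h1.2]

/-- Moving a direction `z` of the cone of feasible directions along `z'` until it hits a further
facet. -/
theorem exists_hit_facet {x z z' : Fin n → ℝ}
    (hz : ∀ i, realRow A i ⬝ᵥ x = b i → realRow A i ⬝ᵥ z ≤ 0)
    (hz' : ∀ i, realRow A i ⬝ᵥ x = b i → realRow A i ⬝ᵥ z = 0 → realRow A i ⬝ᵥ z' = 0)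
    (hpos : ∃ i, realRow A i ⬝ᵥ x = b i ∧ 0 < realRow A i ⬝ᵥ z') :
    ∃ t : ℝ, 0 < t ∧
      (∀ i, realRow A i ⬝ᵥ x = b i → realRow A i ⬝ᵥ (z + t • z') ≤ 0) ∧
      ∃ i, realRow A i ⬝ᵥ x = b i ∧ realRow A i ⬝ᵥ z < 0 ∧
        realRow A i ⬝ᵥ (z + t • z') = 0 := by
  classical
  obtain ⟨i, hi, hmin⟩ := Finset.exists_min_image
    (Finset.univ.filter fun i => realRow A i ⬝ᵥ x = b i ∧ 0 < realRow A i ⬝ᵥ z')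
    (fun i => -(realRow A i ⬝ᵥ z) / (realRow A i ⬝ᵥ z'))
    (hpos.imp fun i hi => by simpa using hi)
  simp only [Finset.mem_filter, Finset.mem_univ, true_and] at hi hmin
  have hneg : realRow A i ⬝ᵥ z < 0 :=
    lt_of_le_of_ne (hz i hi.1) fun h => hi.2.ne' (hz' i hi.1 h)
  have ht : 0 < -(realRow A i ⬝ᵥ z) / (realRow A i ⬝ᵥ z') := div_pos (neg_pos.2 hneg) hi.2
  refine ⟨_, ht, fun l hl => ?_, i, hi.1, hneg, ?_⟩
  · rw [dotProduct_add, dotProduct_smul, smul_eq_mul]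
    by_cases hl' : 0 < realRow A l ⬝ᵥ z'
    · have := (le_div_iff₀ hl').1 (hmin l ⟨hl, hl'⟩)
      linarith
    · have := mul_nonpos_of_nonneg_of_nonpos ht.le (not_lt.1 hl')
      linarith [hz l hl]
  · rw [dotProduct_add, dotProduct_smul, smul_eq_mul, div_mul_cancel₀ _ hi.2.ne']
    ring

/-- If `h` improves along some feasible direction at a vertex, then it improves along an extreme
ray of the cone of feasible directions. -/
theorem exists_edge_direction {x : Fin n → ℝ}
    (hsep : ∀ z : Fin n → ℝ, (∀ i, realRow A i ⬝ᵥ x = b i → realRow A i ⬝ᵥ z = 0) → z = 0)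
    {h z : Fin n → ℝ} (hz : ∀ i, realRow A i ⬝ᵥ x = b i → realRow A i ⬝ᵥ z ≤ 0)
    (hhz : 0 < h ⬝ᵥ z) :
    ∃ y : Fin n → ℝ, (∀ i, realRow A i ⬝ᵥ x = b i → realRow A i ⬝ᵥ y ≤ 0) ∧ 0 < h ⬝ᵥ y ∧
      ∀ z', (∀ i, realRow A i ⬝ᵥ x = b i → realRow A i ⬝ᵥ y = 0 → realRow A i ⬝ᵥ z' = 0) →
        ∃ α : ℝ, z' = α • y := by
  classical
  -- Each move makes one more tight row vanish on `z` while keeping those that already do.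
  induction hN : (Finset.univ.filter fun i => realRow A i ⬝ᵥ x = b i ∧ realRow A i ⬝ᵥ z < 0).card
    using Nat.strong_induction_on generalizing z with
  | _ N ih =>
  by_cases hex : ∀ z', (∀ i, realRow A i ⬝ᵥ x = b i → realRow A i ⬝ᵥ z = 0 →
      realRow A i ⬝ᵥ z' = 0) → ∃ α : ℝ, z' = α • z
  · exact ⟨z, hz, hhz, hex⟩
  push Not at hex
  obtain ⟨z₁, hz₁, hne⟩ := hex
  have recurse : ∀ (z' : Fin n → ℝ) (t : ℝ),
      (∀ i, realRow A i ⬝ᵥ x = b i → realRow A i ⬝ᵥ z = 0 → realRow A i ⬝ᵥ z' = 0) →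
      (∀ i, realRow A i ⬝ᵥ x = b i → realRow A i ⬝ᵥ (z + t • z') ≤ 0) →
      (∃ i, realRow A i ⬝ᵥ x = b i ∧ realRow A i ⬝ᵥ z < 0 ∧
        realRow A i ⬝ᵥ (z + t • z') = 0) → 0 < h ⬝ᵥ (z + t • z') →
      ∃ y : Fin n → ℝ, (∀ i, realRow A i ⬝ᵥ x = b i → realRow A i ⬝ᵥ y ≤ 0) ∧ 0 < h ⬝ᵥ y ∧
        ∀ z', (∀ i, realRow A i ⬝ᵥ x = b i → realRow A i ⬝ᵥ y = 0 → realRow A i ⬝ᵥ z' = 0) →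
          ∃ α : ℝ, z' = α • y := by
    rintro z' t h0 hle ⟨i, hi, hneg, heq⟩ hpos
    refine ih _ ?_ hle hpos rfl
    rw [← hN]
    refine Finset.card_lt_card ((Finset.ssubset_iff_of_subset fun l hl => ?_).2 ⟨i, ?_, ?_⟩)
    · simp only [Finset.mem_filter, Finset.mem_univ, true_and] at hl ⊢
      refine ⟨hl.1, lt_of_le_of_ne (hz l hl.1) fun h' => hl.2.ne ?_⟩
      rw [dotProduct_add, dotProduct_smul, h0 l hl.1 h', h', smul_zero, add_zero]
    · simpa using ⟨hi, hneg⟩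
    · rw [Finset.mem_filter]
      exact fun hmem => hmem.2.2.ne heq
  -- the functional `g` is positive on nonzero feasible directions
  let g : (Fin n → ℝ) → ℝ := fun y =>
    ∑ i ∈ Finset.univ.filter (fun i => realRow A i ⬝ᵥ x = b i), realRow A i ⬝ᵥ y
  -- On a feasible direction all terms of `g` are nonpositive, and they vanish together only at 0.
  have hgz : g z < 0 := by
    refine lt_of_le_of_ne (Finset.sum_nonpos fun i hi => hz i (by simpa using hi)) fun h0 => ?_
    have := (Finset.sum_eq_zero_iff_of_nonpos fun i hi => hz i (by simpa using hi)).1 h0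
    rw [hsep z fun i hi => this i (by simpa using hi), dotProduct_zero] at hhz
    exact lt_irrefl _ hhz
  -- Correcting `z₁` by a multiple of `z` gives `g z' = 0` with `z' ≠ 0`. Hence neither `z'` nor
  -- `-z'` is a feasible direction, and moving `z` either way hits a facet.
  set z' := z₁ - (g z₁ / g z) • z with hz'def
  have hz'0 : ∀ i, realRow A i ⬝ᵥ x = b i → realRow A i ⬝ᵥ z = 0 → realRow A i ⬝ᵥ z' = 0 := by
    intro i hi h0
    rw [hz'def, dotProduct_sub, dotProduct_smul, hz₁ i hi h0, h0, smul_zero, sub_zero]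
  have hz'ne : z' ≠ 0 := fun h0 => hne _ (sub_eq_zero.1 h0)
  have hgz' : g z' = 0 := by
    have : g z' = g z₁ - (g z₁ / g z) * g z := by
      simp only [g, hz'def, dotProduct_sub, dotProduct_smul, smul_eq_mul, Finset.sum_sub_distrib,
        Finset.mul_sum]
    rw [this, div_mul_cancel₀ _ hgz.ne, sub_self]
  have hboth : ∀ y : Fin n → ℝ, y ≠ 0 → g y = 0 →
      ∃ i, realRow A i ⬝ᵥ x = b i ∧ 0 < realRow A i ⬝ᵥ y := by
    intro y hy hgy
    by_contra! hle
    have := (Finset.sum_eq_zero_iff_of_nonpos fun i hi => hle i (by simpa using hi)).1 hgy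
    exact hy (hsep y fun i hi => this i (by simpa using hi))
  obtain ⟨t, ht, htle, hthit⟩ := exists_hit_facet hz hz'0 (hboth z' hz'ne hgz')
  obtain ⟨s, hs, hsle, hshit⟩ := exists_hit_facet (z' := -z') hz
    (fun i hi h0 => by rw [dotProduct_neg, hz'0 i hi h0, neg_zero])
    (hboth (-z') (neg_ne_zero.2 hz'ne) (by
      simp only [g, dotProduct_neg, Finset.sum_neg_distrib, neg_eq_zero]
      exact hgz'))
  -- Of the two ways, take one along which `h` does not decrease.
  by_cases hpos : 0 < h ⬝ᵥ z'
  · refine recurse z' t hz'0 htle hthit ?_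
    rw [dotProduct_add, dotProduct_smul, smul_eq_mul]
    exact add_pos hhz (mul_pos ht hpos)
  · refine recurse (-z') s (fun i hi h0 => by rw [dotProduct_neg, hz'0 i hi h0, neg_zero])
      hsle hshit ?_
    rw [dotProduct_add, dotProduct_smul, smul_eq_mul, dotProduct_neg]
    exact add_pos_of_pos_of_nonneg hhz (mul_nonneg hs.le (neg_nonneg.2 (not_lt.1 hpos)))

/-- A vertex that is no worse than its neighbours is optimal. -/
theorem isOptimal_of_forall_neighbor {k : ℕ}
    (hbd : ∀ x ∈ polyhedron A b, ∀ j, 0 ≤ x j ∧ x j ≤ (k : ℝ)) {x h : Fin n → ℝ}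
    (hx : x ∈ (polyhedron A b).extremePoints ℝ)
    (hloc : ∀ u, Neighbor (polyhedron A b) x u → h ⬝ᵥ u ≤ h ⬝ᵥ x) :
    IsOptimal (polyhedron A b) h x := by
  have hxP : x ∈ polyhedron A b := hx.1
  refine ⟨hxP, fun y hy => not_lt.1 fun hlt => ?_⟩
  obtain ⟨z, hz, hhz, hray⟩ := exists_edge_direction (z := y - x)
    (fun z hz => eq_zero_of_tight_of_mem_extremePoints hx hz)
    (fun i hi => by rw [dotProduct_sub, hi]; linarith [hy i])
    (by rw [dotProduct_sub]; linarith)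
  have hz0 : z ≠ 0 := by
    rintro rfl
    simp at hhz
  obtain ⟨j, hj, hmin⟩ := exists_minimal_ratio A b (x := x)
    (exists_realRow_dotProduct_pos hbd hxP hz0)
  obtain ⟨-, hu, hju⟩ := ratio_test hxP hj hmin
  have ht : 0 < ((b j : ℝ) - realRow A j ⬝ᵥ x) / (realRow A j ⬝ᵥ z) :=
    div_pos (sub_pos.2 (lt_of_le_of_ne (hxP j) fun h => absurd hj (not_lt.2 (hz j h)))) hj
  obtain ⟨i, hi, hiz⟩ : ∃ i, realRow A i ⬝ᵥ x = b i ∧ realRow A i ⬝ᵥ z < 0 := by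
    by_contra! hge
    exact hz0 (eq_zero_of_tight_of_mem_extremePoints hx fun i hi =>
      le_antisymm (hz i hi) (hge i hi))
  have hnb := neighbor_add_smul hxP ht hu
    (F := {i | realRow A i ⬝ᵥ x = b i ∧ realRow A i ⬝ᵥ z = 0})
    (fun i hi => hi.1) (fun i hi => hi.2) (fun z' hz' => hray z' fun i h1 h2 => hz' i ⟨h1, h2⟩)
    hi hiz hju hj
  have := hloc _ hnb
  rw [dotProduct_add, dotProduct_smul, smul_eq_mul] at this
  linarith [mul_pos ht hhz]

end

/-! ### Starting bases -/

section

variable {m n : ℕ} {A : Matrix (Fin m) (Fin n) ℤ} {b : Fin m → ℤ}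

theorem card_add_finrank_ker_realRow {s : Finset (Fin m)}
    (hs : LinearIndependent ℝ (fun i : s => realRow A i)) :
    s.card + Module.finrank ℝ
      (LinearMap.ker (Matrix.mulVecLin (Matrix.of fun i : s => realRow A i))) = n := by
  have h1 := LinearIndependent.rank_matrix (M := Matrix.of fun i : s => realRow A i) hs
  have h2 := LinearMap.finrank_range_add_finrank_ker
    (Matrix.mulVecLin (Matrix.of fun i : s => realRow A i))
  rw [Module.finrank_fin_fun] at h2
  rw [Matrix.rank, Fintype.card_coe] at h1
  rw [h1] at h2
  exact h2

theorem mem_ker_mulVecLin_realRow {s : Finset (Fin m)} {z : Fin n → ℝ} :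
    z ∈ LinearMap.ker (Matrix.mulVecLin (Matrix.of fun i : s => realRow A i)) ↔
      ∀ i ∈ s, realRow A i ⬝ᵥ z = 0 := by
  rw [LinearMap.mem_ker]
  exact ⟨fun h i hi => congrFun h ⟨i, hi⟩, fun h => funext fun i => h i i.2⟩

/-- A midpoint is strict for every row that is strict at one of its ends, so averaging in one
witness per row leads to a relative interior point. -/
theorem exists_strictly_feasible {x : Fin n → ℝ} (hx : x ∈ polyhedron A b)
    (s : Finset (Fin m)) :
    ∃ y ∈ polyhedron A b, ∀ i ∈ s, (∃ y' ∈ polyhedron A b, realRow A i ⬝ᵥ y' < b i) →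
      realRow A i ⬝ᵥ y < b i := by
  classical
  induction s using Finset.induction_on with
  | empty => exact ⟨x, hx, by simp⟩
  | insert j s _ ih =>
    obtain ⟨y, hy, hys⟩ := ih
    by_cases hj : ∃ y' ∈ polyhedron A b, realRow A j ⬝ᵥ y' < b j
    · obtain ⟨y', hy', hlt⟩ := hj
      have hmid : ∀ i, realRow A i ⬝ᵥ ((1 / 2 : ℝ) • y + (1 / 2 : ℝ) • y') =
          (realRow A i ⬝ᵥ y + realRow A i ⬝ᵥ y') / 2 := fun i => by
        rw [dotProduct_add, dotProduct_smul, dotProduct_smul, smul_eq_mul, smul_eq_mul]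
        ring
      refine ⟨(1 / 2 : ℝ) • y + (1 / 2 : ℝ) • y',
        convex_polyhedron hy hy' (by norm_num) (by norm_num) (by norm_num),
        fun i hi hex => ?_⟩
      rw [hmid]
      rcases Finset.mem_insert.1 hi with rfl | hi
      · linarith [hy i]
      · linarith [hys i hi hex, hy' i]
    · refine ⟨y, hy, fun i hi hex => ?_⟩
      rcases Finset.mem_insert.1 hi with rfl | hi
      · exact absurd hex hj
      · exact hys i hi hex

/-- The direction space of a nonempty polyhedron is the annihilator of the rows that are constant
on it. -/
theorem mem_vectorSpan_polyhedron_iff {x : Fin n → ℝ} (hx : x ∈ polyhedron A b)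
    {z : Fin n → ℝ} :
    z ∈ vectorSpan ℝ (polyhedron A b) ↔
      ∀ i, (∀ y ∈ polyhedron A b, realRow A i ⬝ᵥ y = b i) → realRow A i ⬝ᵥ z = 0 := by
  constructor
  · intro hz i hi
    rw [vectorSpan_def] at hz
    induction hz using Submodule.span_induction with
    | mem v hv =>
      obtain ⟨p, hp, q, hq, rfl⟩ := hv
      change realRow A i ⬝ᵥ (p - q) = 0
      rw [dotProduct_sub, hi p hp, hi q hq, sub_self]
    | zero => simp
    | add u v _ _ hu hv => rw [dotProduct_add, hu, hv, add_zero]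
    | smul a v _ hv => rw [dotProduct_smul, hv, smul_zero]
  · intro hz
    obtain ⟨y, hy, hys⟩ := exists_strictly_feasible hx Finset.univ
    obtain ⟨ε, hε, hmem⟩ := exists_add_smul_mem_polyhedron (z := z) hy fun i hi => by
      refine (hz i fun y' hy' => ?_).le
      by_contra hne
      exact (hys i (Finset.mem_univ i) ⟨y', hy', lt_of_le_of_ne (hy' i) hne⟩).ne hi
    have h := (vectorSpan ℝ (polyhedron A b)).smul_mem ε⁻¹ (vsub_mem_vectorSpan ℝ hmem hy)
    rwa [vsub_eq_sub, add_sub_cancel_left, smul_smul, inv_mul_cancel₀ hε.ne', one_smul] at h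

/-- A maximal independent set `E₀` of rows constant on `P` is extended to a maximal independent set
`B₀` of tight rows. The common kernel is the direction space of `P` for `E₀` and trivial for `B₀`,
so `E₀` has `n - d` elements and `B₀` has `n`. -/
theorem exists_isLatticeStart {x : Fin n → ℝ} (hx : x ∈ (polyhedron A b).extremePoints ℝ) :
    ∃ B, IsLatticeStart A b B x := by
  classical
  have hxP : x ∈ polyhedron A b := hx.1
  let E : Set (Fin m) := {i | ∀ y ∈ polyhedron A b, realRow A i ⬝ᵥ y = b i}
  let T : Set (Fin m) := {i | realRow A i ⬝ᵥ x = b i}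
  have hET : E ⊆ T := fun i hi => hi x hxP
  obtain ⟨E₀, hE₀E, -, hspanE, hE₀⟩ :=
    exists_linearIndepOn_extension (linearIndepOn_empty ℝ (realRow A)) (Set.empty_subset E)
  obtain ⟨B₀, hB₀T, hE₀B₀, hspanT, hB₀⟩ :=
    exists_linearIndepOn_extension hE₀ (hE₀E.trans hET)
  have hB : LinearIndependent ℝ (fun i : B₀.toFinset => realRow A i) := by
    have : LinearIndepOn ℝ (realRow A) (↑B₀.toFinset : Set (Fin m)) := by
      rwa [Set.coe_toFinset]
    exact this
  have hE : LinearIndependent ℝ (fun i : E₀.toFinset => realRow A i) := by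
    have : LinearIndepOn ℝ (realRow A) (↑E₀.toFinset : Set (Fin m)) := by
      rwa [Set.coe_toFinset]
    exact this
  have hBcard : B₀.toFinset.card = n := by
    have h := card_add_finrank_ker_realRow hB
    have hker : LinearMap.ker (Matrix.mulVecLin (Matrix.of fun i : B₀.toFinset => realRow A i)) =
        ⊥ := by
      refine (Submodule.eq_bot_iff _).2 fun z hz => ?_
      rw [mem_ker_mulVecLin_realRow] at hz
      exact eq_zero_of_tight_of_mem_extremePoints hx fun i hi =>
        dotProduct_eq_zero_of_mem_span_realRow (fun l hl => hz l (Set.mem_toFinset.2 hl))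
          (hspanT ⟨i, hi, rfl⟩)
    rwa [hker, finrank_bot, add_zero] at h
  have hEcard : E₀.toFinset.card + polyDim (polyhedron A b) = n := by
    have h := card_add_finrank_ker_realRow hE
    have hker : LinearMap.ker (Matrix.mulVecLin (Matrix.of fun i : E₀.toFinset => realRow A i)) =
        vectorSpan ℝ (polyhedron A b) := by
      ext z
      rw [mem_ker_mulVecLin_realRow, mem_vectorSpan_polyhedron_iff hxP]
      refine ⟨fun hz i hi => dotProduct_eq_zero_of_mem_span_realRow
        (fun l hl => hz l (Set.mem_toFinset.2 hl)) (hspanE ⟨i, hi, rfl⟩),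
        fun hz i hi => hz i (hE₀E (Set.mem_toFinset.1 hi))⟩
    rwa [hker] at h
  refine ⟨B₀.toFinset, ⟨hxP, fun i hi => hB₀T (Set.mem_toFinset.1 hi), hB, hBcard⟩, ?_⟩
  have hset : {i | i ∈ B₀.toFinset ∧ ∃ y ∈ polyhedron A b, realRow A i ⬝ᵥ y < (b i : ℝ)} =
      ↑(B₀.toFinset \ E₀.toFinset) := by
    ext i
    simp only [Set.mem_ofPred_eq, Finset.coe_sdiff, Set.coe_toFinset, Set.mem_toFinset,
      Set.mem_sdiff]
    refine and_congr_right fun hiB => ⟨?_, fun hiE₀ => ?_⟩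
    · rintro ⟨y, hy, hlt⟩ hiE₀
      exact hlt.ne (hE₀E hiE₀ y hy)
    -- A row of `B₀` outside `E₀` that is constant on `P` would lie in the span of `E₀`, against
    -- independence of `B₀`.
    · by_contra! hge
      have hiE : i ∈ E := fun y hy => le_antisymm (hy i) (hge y hy)
      exact hE₀.notMem_span_iff.2
        ⟨hB₀.mono (Set.insert_subset hiB hE₀B₀), hiE₀⟩ (hspanE ⟨i, hiE, rfl⟩)
  rw [hset, Set.ncard_coe_finset, Finset.card_sdiff_of_subset (Set.toFinset_subset_toFinset.2 hE₀B₀)]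
  omega

/-! ### The range of the auxiliary vector -/

theorem realRow_dotProduct_sub_le {k : ℕ}
    (hbd : ∀ x ∈ polyhedron A b, ∀ j, 0 ≤ x j ∧ x j ≤ (k : ℝ)) {x y : Fin n → ℝ}
    (hx : x ∈ polyhedron A b) (hy : y ∈ polyhedron A b) (i : Fin m) :
    realRow A i ⬝ᵥ (x - y) ≤ ((n * k * entryNorm A : ℕ) : ℝ) := by
  have hterm : ∀ j, realRow A i j * (x - y) j ≤ (k * entryNorm A : ℝ) := by
    intro j
    have h1 : |realRow A i j| ≤ (entryNorm A : ℝ) := by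
      have : (A i j).natAbs ≤ entryNorm A :=
        Finset.le_sup (f := fun p : Fin m × Fin n => (A p.1 p.2).natAbs) (Finset.mem_univ (i, j))
      rw [realRow, ← Int.cast_abs, Int.abs_eq_natAbs]
      exact_mod_cast this
    have h2 : |(x - y) j| ≤ (k : ℝ) := by
      have hxj := hbd x hx j
      have hyj := hbd y hy j
      rw [Pi.sub_apply, abs_le]
      constructor <;> linarith
    calc realRow A i j * (x - y) j ≤ |realRow A i j * (x - y) j| := le_abs_self _
      _ = |(x - y) j| * |realRow A i j| := by rw [abs_mul, mul_comm]
      _ ≤ k * entryNorm A := mul_le_mul h2 h1 (abs_nonneg _) (by positivity)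
  calc realRow A i ⬝ᵥ (x - y) ≤ ∑ _j : Fin n, (k * entryNorm A : ℝ) :=
        Finset.sum_le_sum fun j _ => hterm j
    _ = ((n * k * entryNorm A : ℕ) : ℝ) := by
        rw [Finset.sum_const, Finset.card_univ, Fintype.card_fin, nsmul_eq_mul]
        push_cast
        ring

theorem auxVector_dotProduct_sub_le {k : ℕ}
    (hbd : ∀ x ∈ polyhedron A b, ∀ j, 0 ≤ x j ∧ x j ≤ (k : ℝ)) {B : Finset (Fin m)}
    {x y : Fin n → ℝ} (hB : IsLatticeStart A b B x) (hy : y ∈ polyhedron A b) :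
    auxVector A B ⬝ᵥ y - auxVector A B ⬝ᵥ x ≤
      ((polyDim (polyhedron A b) * n * k * entryNorm A : ℕ) : ℝ) := by
  classical
  have hset : {i | i ∈ B ∧ ∃ y ∈ polyhedron A b, realRow A i ⬝ᵥ y < (b i : ℝ)} =
      ↑(B.filter fun i => ∃ y ∈ polyhedron A b, realRow A i ⬝ᵥ y < (b i : ℝ)) := by
    ext i; simp
  have hcard := hB.2
  rw [hset, Set.ncard_coe_finset] at hcard
  have h1 : auxVector A B ⬝ᵥ y - auxVector A B ⬝ᵥ x = ∑ i ∈ B, realRow A i ⬝ᵥ (x - y) := by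
    simp only [auxVector, neg_dotProduct, sum_dotProduct, dotProduct_sub, Finset.sum_sub_distrib]
    ring
  have h2 : ∑ i ∈ B, realRow A i ⬝ᵥ (x - y) =
      ∑ i ∈ B.filter fun i => ∃ y ∈ polyhedron A b, realRow A i ⬝ᵥ y < (b i : ℝ),
        realRow A i ⬝ᵥ (x - y) := by
    refine (Finset.sum_filter_of_ne fun i hi hne => ?_).symm
    refine ⟨y, hy, lt_of_le_of_ne (hy i) fun h => hne ?_⟩
    rw [dotProduct_sub, h, hB.1.tight i hi, sub_self]
  rw [h1, h2]
  refine (Finset.sum_le_card_nsmul _ _ _ fun i _ =>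
    realRow_dotProduct_sub_le hbd hB.1.feasible hy i).trans (le_of_eq ?_)
  rw [hcard, nsmul_eq_mul]
  push_cast
  ring

end

/-! ### The shadow edge-pivot rule -/

section

variable {m n k : ℕ} {A : Matrix (Fin m) (Fin n) ℤ} {b : Fin m → ℤ}

theorem IsLatticePolytope.exists_int_eq {P : Set (Fin n → ℝ)} (hP : IsLatticePolytope k P)
    {x : Fin n → ℝ} (hx : x ∈ P.extremePoints ℝ) : ∃ v : Fin n → ℤ, x = fun j => (v j : ℝ) := by
  obtain ⟨⟨V, rfl⟩, -⟩ := hP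
  obtain ⟨v, -, rfl⟩ := extremePoints_convexHull_subset hx
  exact ⟨v, rfl⟩

theorem IsLatticePolytope.finite_extremePoints {P : Set (Fin n → ℝ)}
    (hP : IsLatticePolytope k P) : (P.extremePoints ℝ).Finite := by
  obtain ⟨⟨V, rfl⟩, -⟩ := hP
  exact (V.finite_toSet.image _).subset extremePoints_convexHull_subset

theorem exists_int_auxVector_dotProduct_eq (B : Finset (Fin m)) (v : Fin n → ℤ) :
    ∃ q : ℤ, auxVector A B ⬝ᵥ (fun j => (v j : ℝ)) = q := by
  refine ⟨-∑ i ∈ B, ∑ j, A i j * v j, ?_⟩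
  rw [auxVector, neg_dotProduct, sum_dotProduct]
  push_cast
  rfl

theorem auxVector_dotProduct_add_one_le (hP : IsLatticePolytope k (polyhedron A b))
    {B : Finset (Fin m)} {x u : Fin n → ℝ} (hx : x ∈ (polyhedron A b).extremePoints ℝ)
    (hu : u ∈ (polyhedron A b).extremePoints ℝ) (hlt : auxVector A B ⬝ᵥ x < auxVector A B ⬝ᵥ u) :
    auxVector A B ⬝ᵥ x + 1 ≤ auxVector A B ⬝ᵥ u := by
  obtain ⟨v, rfl⟩ := hP.exists_int_eq hx
  obtain ⟨v', rfl⟩ := hP.exists_int_eq hu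
  obtain ⟨q, hq⟩ := exists_int_auxVector_dotProduct_eq (A := A) B v
  obtain ⟨q', hq'⟩ := exists_int_auxVector_dotProduct_eq (A := A) B v'
  rw [hq, hq'] at hlt ⊢
  exact_mod_cast Int.add_one_le_iff.2 (by exact_mod_cast hlt)

/-- A point lies on the shadow path if it is optimal for `c - lam • w` with some `lam ≥ 0`. -/
def IsParametricOptimal (P : Set (Fin n → ℝ)) (c w x : Fin n → ℝ) : Prop :=
  ∃ lam : ℝ, 0 ≤ lam ∧ IsOptimal P (c - lam • w) x

/-- In the plane of values of `w` and `c`, the shadow of `P` lies below a line of slope `lam`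
through the image of `x`. -/
theorem IsParametricOptimal.exists_slope_le {P : Set (Fin n → ℝ)} {c w x : Fin n → ℝ}
    (h : IsParametricOptimal P c w x) :
    ∃ lam : ℝ, 0 ≤ lam ∧ ∀ y ∈ P, c ⬝ᵥ (y - x) ≤ lam * w ⬝ᵥ (y - x) := by
  obtain ⟨lam, h0, -, hopt⟩ := h
  refine ⟨lam, h0, fun y hy => ?_⟩
  have := hopt y hy
  simp only [sub_dotProduct, smul_dotProduct, smul_eq_mul] at this
  rw [dotProduct_sub, dotProduct_sub]
  linarith

theorem Neighbor.right_mem {P : Set (Fin n → ℝ)} {u v : Fin n → ℝ} (h : Neighbor P u v) :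
    v ∈ P :=
  h.2.1.1

/-- Local optimality yields a `c`-improving neighbor; the slope bound with `lam ≥ 0` then forces `w`
to increase too. -/
theorem exists_improving_neighbor
    (hbd : ∀ x ∈ polyhedron A b, ∀ j, 0 ≤ x j ∧ x j ≤ (k : ℝ)) {c w x : Fin n → ℝ}
    (hx : x ∈ (polyhedron A b).extremePoints ℝ)
    (hpar : IsParametricOptimal (polyhedron A b) c w x)
    (hopt : ¬ IsOptimal (polyhedron A b) c x) :
    ∃ u ∈ improvingNeighbors (polyhedron A b) w x, 0 < c ⬝ᵥ (u - x) := by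
  obtain ⟨lam, h0, hlam⟩ := hpar.exists_slope_le
  obtain ⟨u, hu, hlt⟩ : ∃ u, Neighbor (polyhedron A b) x u ∧ c ⬝ᵥ x < c ⬝ᵥ u := by
    by_contra! hle
    exact hopt (isOptimal_of_forall_neighbor hbd hx hle)
  have hpos : 0 < c ⬝ᵥ (u - x) := by rw [dotProduct_sub]; linarith
  have hw : 0 < w ⬝ᵥ (u - x) :=
    pos_of_mul_pos_right (hpos.trans_le (hlam u hu.right_mem)) h0
  rw [dotProduct_sub, sub_pos] at hw
  exact ⟨u, ⟨hu, hw⟩, hpos⟩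

theorem exists_isShadowStep (hP : IsLatticePolytope k (polyhedron A b)) {c w x : Fin n → ℝ}
    (hx : x ∈ (polyhedron A b).extremePoints ℝ)
    (hpar : IsParametricOptimal (polyhedron A b) c w x)
    (hopt : ¬ IsOptimal (polyhedron A b) c x) :
    ∃ u, IsShadowStep (polyhedron A b) c w x u := by
  obtain ⟨u, hu, -⟩ := exists_improving_neighbor hP.2 hx hpar hopt
  have hfin : (improvingNeighbors (polyhedron A b) w x).Finite :=
    hP.finite_extremePoints.subset fun v hv => hv.1.2.1
  exact Set.exists_max_image _ (fun u => (c ⬝ᵥ (u - x)) / (w ⬝ᵥ (u - x))) hfin ⟨u, hu⟩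

/-- A shadow step improves `c` and stays on the shadow path. -/
theorem IsShadowStep.improves
    (hbd : ∀ x ∈ polyhedron A b, ∀ j, 0 ≤ x j ∧ x j ≤ (k : ℝ)) {c w x u : Fin n → ℝ}
    (hpar : IsParametricOptimal (polyhedron A b) c w x)
    (hopt : ¬ IsOptimal (polyhedron A b) c x) (hu : IsShadowStep (polyhedron A b) c w x u) :
    c ⬝ᵥ x < c ⬝ᵥ u ∧ IsParametricOptimal (polyhedron A b) c w u := by
  have hx : x ∈ (polyhedron A b).extremePoints ℝ := hu.1.1.1
  obtain ⟨v, hv, hcv⟩ := exists_improving_neighbor hbd hx hpar hopt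
  obtain ⟨lam, h0, hlam⟩ := hpar.exists_slope_le
  have hwpos : ∀ u' ∈ improvingNeighbors (polyhedron A b) w x, 0 < w ⬝ᵥ (u' - x) :=
    fun u' hu' => by rw [dotProduct_sub, sub_pos]; exact hu'.2
  set mu := (c ⬝ᵥ (u - x)) / (w ⬝ᵥ (u - x)) with hmu
  have hmupos : 0 < mu := (div_pos hcv (hwpos v hv)).trans_le (hu.2 v hv)
  have hmule : mu ≤ lam :=
    (div_le_iff₀ (hwpos u hu.1)).2 (hlam u hu.1.1.right_mem)
  have heq : c ⬝ᵥ (u - x) = mu * w ⬝ᵥ (u - x) := by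
    rw [hmu, div_mul_cancel₀ _ (hwpos u hu.1).ne']
  have hxopt : IsOptimal (polyhedron A b) (c - mu • w) x := by
    -- Neighbors that improve `w` obey slope `mu` by the choice of `u`; for the others the change in
    -- `w` is nonpositive, so the bound with `lam` passes to `mu ≤ lam`.
    refine isOptimal_of_forall_neighbor hbd hx fun u' hu' => ?_
    have key : c ⬝ᵥ (u' - x) ≤ mu * w ⬝ᵥ (u' - x) := by
      by_cases hw : w ⬝ᵥ x < w ⬝ᵥ u'
      · exact (div_le_iff₀ (hwpos u' ⟨hu', hw⟩)).1 (hu.2 u' ⟨hu', hw⟩)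
      · refine (hlam u' hu'.right_mem).trans (mul_le_mul_of_nonpos_right hmule ?_)
        rw [dotProduct_sub]
        linarith
    rw [dotProduct_sub, dotProduct_sub] at key
    simp only [sub_dotProduct, smul_dotProduct, smul_eq_mul]
    linarith
  refine ⟨?_, mu, hmupos.le, hu.1.1.right_mem, fun y hy => (hxopt.2 y hy).trans (le_of_eq ?_)⟩
  · have := mul_pos hmupos (hwpos u hu.1)
    rw [← heq, dotProduct_sub] at this
    linarith
  · rw [dotProduct_sub, dotProduct_sub] at heq
    simp only [sub_dotProduct, smul_dotProduct, smul_eq_mul]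
    linarith

theorem IsTightBasis.isParametricOptimal {B : Finset (Fin m)} {x : Fin n → ℝ}
    (hB : IsTightBasis A b B x) (c : Fin n → ℝ) :
    IsParametricOptimal (polyhedron A b) c (auxVector A B) x := by
  obtain ⟨lam, h0, hlam⟩ := exists_dual_feasible_auxVector hB.indep hB.card_eq c
  exact ⟨lam, h0, isOptimal_of_forall_isBasicDirection hB hlam⟩

theorem IsShadowRun.invariants
    (hbd : ∀ x ∈ polyhedron A b, ∀ j, 0 ≤ x j ∧ x j ≤ (k : ℝ)) {c w : Fin n → ℝ} {T : ℕ}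
    {x : ℕ → Fin n → ℝ} (hx : x 0 ∈ (polyhedron A b).extremePoints ℝ)
    (hpar : IsParametricOptimal (polyhedron A b) c w (x 0))
    (hrun : IsShadowRun (polyhedron A b) c w T x) {s : ℕ} (hs : s ≤ T) :
    x s ∈ (polyhedron A b).extremePoints ℝ ∧
      IsParametricOptimal (polyhedron A b) c w (x s) := by
  induction s with
  | zero => exact ⟨hx, hpar⟩
  | succ s ih =>
    have h := hrun s hs
    exact ⟨h.2.1.1.2.1, (h.2.improves hbd (ih (by omega)).2 h.1).2⟩

theorem IsShadowRun.isMonotonePath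
    (hbd : ∀ x ∈ polyhedron A b, ∀ j, 0 ≤ x j ∧ x j ≤ (k : ℝ)) {c w : Fin n → ℝ} {T : ℕ}
    {x : ℕ → Fin n → ℝ} (hx : x 0 ∈ (polyhedron A b).extremePoints ℝ)
    (hpar : IsParametricOptimal (polyhedron A b) c w (x 0))
    (hrun : IsShadowRun (polyhedron A b) c w T x) : IsMonotonePath (polyhedron A b) c T x :=
  fun s hs => ⟨(hrun s hs).2.1.1,
    ((hrun s hs).2.improves hbd (hrun.invariants hbd hx hpar hs.le).2 (hrun s hs).1).1⟩

theorem IsShadowRun.length_le (hP : IsLatticePolytope k (polyhedron A b)) {B : Finset (Fin m)}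
    {c : Fin n → ℝ} {T : ℕ} {x : ℕ → Fin n → ℝ} (hB : IsLatticeStart A b B (x 0))
    (hx : x 0 ∈ (polyhedron A b).extremePoints ℝ)
    (hrun : IsShadowRun (polyhedron A b) c (auxVector A B) T x) :
    T ≤ polyDim (polyhedron A b) * n * k * entryNorm A := by
  have hinv := fun s hs =>
    (hrun.invariants hP.2 hx (hB.1.isParametricOptimal c) (s := s) hs).1
  have hgrow : ∀ s ≤ T, auxVector A B ⬝ᵥ x 0 + s ≤ auxVector A B ⬝ᵥ x s := by
    intro s hs
    induction s with
    | zero => simp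
    | succ s ih =>
      have := auxVector_dotProduct_add_one_le hP (hinv s (by omega)) (hinv (s + 1) hs)
        (hrun s hs).2.1.2
      push_cast
      linarith [ih (by omega)]
  have h1 := auxVector_dotProduct_sub_le hP.2 hB (hinv T le_rfl).1
  have h2 := hgrow T le_rfl
  have h3 : (T : ℝ) ≤ ((polyDim (polyhedron A b) * n * k * entryNorm A : ℕ) : ℝ) := by linarith
  exact Nat.cast_le.1 h3

/-- From every vertex there is a monotone path to an optimum of the length that the lattice shadow
rule guarantees. -/
theorem exists_short_monotonePath (hP : IsLatticePolytope k (polyhedron A b)) (c : Fin n → ℝ)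
    {v : Fin n → ℝ} (hv : v ∈ (polyhedron A b).extremePoints ℝ) :
    ∃ L ≤ polyDim (polyhedron A b) * n * k * entryNorm A, ∃ p : ℕ → Fin n → ℝ,
      p 0 = v ∧ IsMonotonePath (polyhedron A b) c L p ∧ IsOptimal (polyhedron A b) c (p L) := by
  classical
  obtain ⟨B, hB⟩ := exists_isLatticeStart hv
  -- The default `x` is never used before an optimum is reached.
  let next : (Fin n → ℝ) → Fin n → ℝ := fun x =>
    if h : ∃ u, IsShadowStep (polyhedron A b) c (auxVector A B) x u then h.choose else x
  let p : ℕ → Fin n → ℝ := fun s => next^[s] v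
  have hpar := hB.1.isParametricOptimal c
  have hrun : ∀ T, (∀ s < T, ¬ IsOptimal (polyhedron A b) c (p s)) →
      IsShadowRun (polyhedron A b) c (auxVector A B) T p := by
    intro T
    induction T with
    | zero => exact fun _ s hs => absurd hs (Nat.not_lt_zero s)
    | succ T ih =>
      intro hno s hs
      have hrun := ih fun s hs => hno s (by omega)
      rcases Nat.lt_succ_iff_lt_or_eq.1 hs with hs | rfl
      · exact hrun s hs
      · have hinv := hrun.invariants hP.2 hv hpar le_rfl
        have hex := exists_isShadowStep hP hinv.1 hinv.2 (hno s (Nat.lt_succ_self s))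
        refine ⟨hno s (Nat.lt_succ_self s), ?_⟩
        have : p (s + 1) = hex.choose := by
          simp only [p, Function.iterate_succ_apply', next]
          exact dif_pos hex
        rw [this]
        exact hex.choose_spec
  have hends : ∃ L, IsOptimal (polyhedron A b) c (p L) := by
    by_contra! hno
    have := (hrun (polyDim (polyhedron A b) * n * k * entryNorm A + 1)
      fun s _ => hno s).length_le hP hB hv
    omega
  have hL := hrun (Nat.find hends) fun s hs => Nat.find_min hends hs
  exact ⟨Nat.find hends, hL.length_le hP hB hv, p, rfl, hL.isMonotonePath hP.2 hv hpar,
    Nat.find_spec hends⟩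

end

/-! ### The Simplex method with the shadow pivot rule -/

/-- A tight basis that is dual feasible for `c - lam • w` with some `lam ≥ 0`. -/
structure IsShadowBasis {m n : ℕ} (A : Matrix (Fin m) (Fin n) ℤ) (b : Fin m → ℤ)
    (c w : Fin n → ℝ) (S : Finset (Fin m) × (Fin n → ℝ)) : Prop where
  tightBasis : IsTightBasis A b S.1 S.2
  dual : ∃ lam : ℝ, 0 ≤ lam ∧
    ∀ i z, IsBasicDirection A S.1 i z → (c - lam • w) ⬝ᵥ z ≤ 0

/-- `z` is a basic direction that the shadow pivot rule may choose. -/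
structure IsShadowDirection {m n : ℕ} (A : Matrix (Fin m) (Fin n) ℤ)
    (c w : Fin n → ℝ) (B : Finset (Fin m)) (i : Fin m) (z : Fin n → ℝ) : Prop where
  basic : IsBasicDirection A B i z
  improves : 0 < c ⬝ᵥ z
  pos : 0 < w ⬝ᵥ z
  slope_le : ∀ i' z', IsBasicDirection A B i' z' → 0 < w ⬝ᵥ z' →
    (c ⬝ᵥ z') / (w ⬝ᵥ z') ≤ (c ⬝ᵥ z) / (w ⬝ᵥ z)

section

variable {m n k : ℕ} {A : Matrix (Fin m) (Fin n) ℤ} {b : Fin m → ℤ} {c w : Fin n → ℝ}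
  {S S' : Finset (Fin m) × (Fin n → ℝ)}

theorem IsTightBasis.isShadowBasis {B : Finset (Fin m)} {x : Fin n → ℝ}
    (hB : IsTightBasis A b B x) (c : Fin n → ℝ) :
    IsShadowBasis A b c (auxVector A B) (B, x) :=
  ⟨hB, exists_dual_feasible_auxVector hB.indep hB.card_eq c⟩

/-- Dual feasibility makes every `c`-improving basic direction `w`-improving, so the maximal ratio
is positive and its maximizer improves `c`. -/
theorem IsShadowBasis.exists_isShadowDirection (hS : IsShadowBasis A b c w S)
    (hopt : ¬ IsOptimalBasis A c S.1) : ∃ i z, IsShadowDirection A c w S.1 i z := by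
  classical
  obtain ⟨hB, lam, h0, hlam⟩ := hS
  have hpos : ∀ i z, IsBasicDirection A S.1 i z → 0 < c ⬝ᵥ z → 0 < w ⬝ᵥ z := by
    intro i z hz hcz
    have := hlam i z hz
    rw [sub_dotProduct, smul_dotProduct, smul_eq_mul] at this
    exact pos_of_mul_pos_right (by linarith) h0
  obtain ⟨Z, hZ⟩ := exists_forall_isBasicDirection hB.indep
  have huniq : ∀ i z, IsBasicDirection A S.1 i z → z = Z i := fun i z hz =>
    isBasicDirection_unique hB.indep hB.card_eq hz (hZ i hz.1)
  obtain ⟨i₀, z₀, hz₀, hc₀⟩ : ∃ i z, IsBasicDirection A S.1 i z ∧ 0 < c ⬝ᵥ z := by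
    by_contra! hle
    exact hopt hle
  have hw₀ := hpos i₀ z₀ hz₀ hc₀
  rw [huniq i₀ z₀ hz₀] at hc₀ hw₀
  obtain ⟨i, hi, hmax⟩ := Finset.exists_max_image (S.1.filter fun i => 0 < w ⬝ᵥ Z i)
    (fun i => (c ⬝ᵥ Z i) / (w ⬝ᵥ Z i)) ⟨i₀, by simpa using ⟨hz₀.1, hw₀⟩⟩
  rw [Finset.mem_filter] at hi
  have hslope : 0 < (c ⬝ᵥ Z i) / (w ⬝ᵥ Z i) :=
    (div_pos hc₀ hw₀).trans_le (hmax i₀ (by simpa using ⟨hz₀.1, hw₀⟩))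
  refine ⟨i, Z i, hZ i hi.1, (div_pos_iff_of_pos_right hi.2).1 hslope, hi.2,
    fun i' z' hz' hw' => ?_⟩
  rw [huniq i' z' hz'] at hw' ⊢
  exact hmax i' (by simpa using ⟨hz'.1, hw'⟩)

/-- At the slope of the chosen direction, the basis remains dual feasible. -/
theorem IsShadowBasis.dual_slope (hS : IsShadowBasis A b c w S) {i : Fin m} {z : Fin n → ℝ}
    (hz : IsShadowDirection A c w S.1 i z) :
    (c - ((c ⬝ᵥ z) / (w ⬝ᵥ z)) • w) ⬝ᵥ z = 0 ∧
      ∀ i' z', IsBasicDirection A S.1 i' z' → (c - ((c ⬝ᵥ z) / (w ⬝ᵥ z)) • w) ⬝ᵥ z' ≤ 0 := by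
  obtain ⟨hB, lam, h0, hlam⟩ := hS
  simp only [sub_dotProduct, smul_dotProduct, smul_eq_mul, sub_nonpos] at hlam ⊢
  refine ⟨by rw [div_mul_cancel₀ _ hz.pos.ne', sub_self], fun i' z' hz' => ?_⟩
  by_cases hw : 0 < w ⬝ᵥ z'
  · exact (div_le_iff₀ hw).1 (hz.slope_le i' z' hz' hw)
  · exact (hlam i' z' hz').trans (mul_le_mul_of_nonpos_right
      ((div_le_iff₀ hz.pos).2 (hlam i z hz.basic)) (not_lt.1 hw))

theorem IsShadowPivot.exists_isShadowDirection (h : IsShadowPivot A b c w S S') :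
    ∃ i z, IsShadowDirection A c w S.1 i z ∧ IsSimplexPivot A b c i z S S' := by
  obtain ⟨i, z, hpiv, hw, hmax⟩ := h
  exact ⟨i, z, ⟨hpiv.1, hpiv.2.1, hw, hmax⟩, hpiv⟩

theorem IsTightBasis.pivot (hB : IsTightBasis A b S.1 S.2) {i : Fin m} {z : Fin n → ℝ}
    (hpiv : IsSimplexPivot A b c i z S S') :
    ∃ t : ℝ, 0 ≤ t ∧ S'.2 = S.2 + t • z ∧ IsTightBasis A b S'.1 S'.2 ∧
      ∃ j, S'.1 = insert j (S.1.erase i) ∧ 0 < realRow A j ⬝ᵥ z ∧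
        realRow A j ⬝ᵥ S'.2 = b j := by
  obtain ⟨hz, -, j, hj, hmin, hS1, hS2⟩ := hpiv
  obtain ⟨h0, hfeas, htight⟩ := ratio_test hB.feasible hj hmin
  obtain ⟨hind, hcard⟩ := linearIndependent_exchange hB.indep hB.card_eq hz hj
  rw [← hS2] at hfeas htight
  refine ⟨_, h0, hS2, ⟨hfeas, fun l hl => ?_, by rw [hS1]; exact hind, by rw [hS1]; exact hcard⟩,
    j, hS1, hj, htight⟩
  rw [hS1] at hl
  rcases Finset.mem_insert.1 hl with rfl | hl
  · exact htight
  · have hl := Finset.mem_erase.1 hl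
    rw [hS2, dotProduct_add, dotProduct_smul, hz.2.2 l hl.2 hl.1, smul_zero, add_zero,
      hB.tight l hl.2]

/-- At the slope of the chosen direction that direction is neutral, so the exchange keeps dual
feasibility whichever row enters. -/
theorem IsShadowBasis.pivot (hS : IsShadowBasis A b c w S) (h : IsShadowPivot A b c w S S') :
    IsShadowBasis A b c w S' := by
  obtain ⟨i, z, hz, hpiv⟩ := h.exists_isShadowDirection
  obtain ⟨t, -, -, hB', j, hS1, -, -⟩ := hS.tightBasis.pivot hpiv
  obtain ⟨heq, hle⟩ := hS.dual_slope hz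
  refine ⟨hB', _, (div_pos hz.improves hz.pos).le, ?_⟩
  rw [hS1]
  exact forall_isBasicDirection_exchange hS.tightBasis.indep hS.tightBasis.card_eq hz.basic hle heq

theorem IsShadowBasis.exists_isShadowPivot
    (hbd : ∀ x ∈ polyhedron A b, ∀ j, 0 ≤ x j ∧ x j ≤ (k : ℝ)) (hS : IsShadowBasis A b c w S)
    (hopt : ¬ IsOptimalBasis A c S.1) : ∃ S', IsShadowPivot A b c w S S' := by
  obtain ⟨i, z, hz⟩ := hS.exists_isShadowDirection hopt
  have hz0 : z ≠ 0 := by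
    rintro rfl
    simpa using hz.pos
  obtain ⟨j, hj, hmin⟩ := exists_minimal_ratio A b (x := S.2)
    (exists_realRow_dotProduct_pos hbd hS.tightBasis.feasible hz0)
  exact ⟨(_, _), i, z, ⟨hz.basic, hz.improves, j, hj, hmin, rfl, rfl⟩, hz.pos, hz.slope_le⟩

/-- A non-degenerate pivot is a step of the edge-pivot rule. -/
theorem IsShadowPivot.isShadowStep (hS : IsShadowBasis A b c w S)
    (h : IsShadowPivot A b c w S S') (hne : S'.2 ≠ S.2) :
    IsShadowStep (polyhedron A b) c w S.2 S'.2 := by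
  obtain ⟨i, z, hz, hpiv⟩ := h.exists_isShadowDirection
  have hB := hS.tightBasis
  obtain ⟨t, h0, hS2, hB', j, hS1, hj, hjt⟩ := hB.pivot hpiv
  have ht : 0 < t := lt_of_le_of_ne h0 fun h => hne (by rw [hS2, ← h, zero_smul, add_zero])
  have hnb : Neighbor (polyhedron A b) S.2 S'.2 := by
    rw [hS2] at hjt ⊢
    refine neighbor_add_smul hB.feasible ht (hS2 ▸ hB'.feasible) (F := {l | l ∈ S.1 ∧ l ≠ i})
      (fun l hl => hB.tight l hl.1) (fun l hl => hz.basic.2.2 l hl.1 hl.2) (fun z' hz' => ?_)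
      (hB.tight i hz.basic.1) (by rw [hz.basic.2.1]; norm_num) hjt hj
    refine ⟨-(realRow A i ⬝ᵥ z'), sub_eq_zero.1
      (eq_zero_of_realRow_dotProduct_eq_zero hB.indep hB.card_eq fun l hl => ?_)⟩
    rw [dotProduct_sub, dotProduct_smul, smul_eq_mul]
    by_cases hli : l = i
    · rw [hli, hz.basic.2.1]
      ring
    · rw [hz' l ⟨hl, hli⟩, hz.basic.2.2 l hl hli]
      ring
  obtain ⟨-, hle⟩ := hS.dual_slope hz
  -- Optimality over all of `P` at this slope bounds the ratio of every edge, including edges that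
  -- are not basic directions of a degenerate basis.
  have hopt := isOptimal_of_forall_isBasicDirection hB hle
  have hratio : (c ⬝ᵥ (S'.2 - S.2)) / (w ⬝ᵥ (S'.2 - S.2)) = (c ⬝ᵥ z) / (w ⬝ᵥ z) := by
    rw [hS2, add_sub_cancel_left, dotProduct_smul, dotProduct_smul, smul_eq_mul, smul_eq_mul,
      mul_div_mul_left _ _ ht.ne']
  refine ⟨⟨hnb, ?_⟩, fun u' hu' => ?_⟩
  · rw [hS2, dotProduct_add, dotProduct_smul, smul_eq_mul]
    linarith [mul_pos ht hz.pos]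
  · have hw : 0 < w ⬝ᵥ (u' - S.2) := by rw [dotProduct_sub, sub_pos]; exact hu'.2
    rw [hratio, div_le_iff₀ hw]
    have := hopt.2 u' hu'.1.right_mem
    simp only [sub_dotProduct, smul_dotProduct, smul_eq_mul] at this
    rw [dotProduct_sub, dotProduct_sub]
    linarith

theorem IsSimplexRun.isShadowBasis {T : ℕ} {S : ℕ → Finset (Fin m) × (Fin n → ℝ)}
    (h0 : IsShadowBasis A b c w (S 0)) (hrun : IsSimplexRun A b c w T S) {s : ℕ} (hs : s ≤ T) :
    IsShadowBasis A b c w (S s) := by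
  induction s with
  | zero => exact h0
  | succ s ih => exact (ih (by omega)).pivot (hrun s hs).2

theorem nondegenerateSteps_succ_le {T : ℕ} {S : ℕ → Finset (Fin m) × (Fin n → ℝ)} :
    nondegenerateSteps (T + 1) S ≤ nondegenerateSteps T S + 1 := by
  have hsub : {s : ℕ | s < T + 1 ∧ (S (s + 1)).2 ≠ (S s).2} ⊆
      insert T {s : ℕ | s < T ∧ (S (s + 1)).2 ≠ (S s).2} := by
    rintro s ⟨hs, hne⟩
    rcases Nat.lt_succ_iff_lt_or_eq.1 hs with h | h
    · exact Or.inr ⟨h, hne⟩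
    · exact Or.inl h
  have hfin : {s : ℕ | s < T ∧ (S (s + 1)).2 ≠ (S s).2}.Finite :=
    (Set.finite_lt_nat T).subset fun s hs => hs.1
  exact (Set.ncard_le_ncard hsub (hfin.insert T)).trans (Set.ncard_insert_le _ _)

theorem nondegenerateSteps_succ_of_eq {T : ℕ} {S : ℕ → Finset (Fin m) × (Fin n → ℝ)}
    (h : (S (T + 1)).2 = (S T).2) : nondegenerateSteps (T + 1) S = nondegenerateSteps T S := by
  unfold nondegenerateSteps
  congr 1
  ext s
  refine ⟨fun ⟨hs, hne⟩ => ⟨lt_of_le_of_ne (Nat.lt_succ_iff.1 hs) ?_, hne⟩,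
    fun ⟨hs, hne⟩ => ⟨hs.trans (Nat.lt_succ_self T), hne⟩⟩
  rintro rfl
  exact hne h

theorem IsSimplexRun.nondegenerateSteps_le (hP : IsLatticePolytope k (polyhedron A b))
    {B : Finset (Fin m)} {x : Fin n → ℝ} (hB : IsLatticeStart A b B x) {T : ℕ}
    {S : ℕ → Finset (Fin m) × (Fin n → ℝ)} (hS : S 0 = (B, x))
    (hrun : IsSimplexRun A b c (auxVector A B) T S) :
    nondegenerateSteps T S ≤ polyDim (polyhedron A b) * n * k * entryNorm A := by
  have hinv := fun s hs => hrun.isShadowBasis (by rw [hS]; exact hB.1.isShadowBasis c) (s := s) hs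
  have hgrow : ∀ s ≤ T,
      auxVector A B ⬝ᵥ x + nondegenerateSteps s S ≤ auxVector A B ⬝ᵥ (S s).2 := by
    intro s hs
    induction s with
    | zero => simp [nondegenerateSteps, hS]
    | succ s ih =>
      have ih := ih (by omega)
      by_cases heq : (S (s + 1)).2 = (S s).2
      · rw [nondegenerateSteps_succ_of_eq heq, heq]
        exact ih
      · have hstep := (hrun s hs).2.isShadowStep (hinv s (by omega)) heq
        have h1 := auxVector_dotProduct_add_one_le hP hstep.1.1.1 hstep.1.1.2.1 hstep.1.2
        have h2 : (nondegenerateSteps (s + 1) S : ℝ) ≤ nondegenerateSteps s S + 1 := by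
          exact_mod_cast nondegenerateSteps_succ_le
        linarith
  have h1 := auxVector_dotProduct_sub_le hP.2 hB (hinv T le_rfl).tightBasis.feasible
  have h2 := hgrow T le_rfl
  have h3 : (nondegenerateSteps T S : ℝ) ≤
      ((polyDim (polyhedron A b) * n * k * entryNorm A : ℕ) : ℝ) := by linarith
  exact Nat.cast_le.1 h3

end

/-! ### Tie-breaking by lexicographic perturbation -/

section

variable {α : Type*} {r : α → α → Prop} {P : α → Prop}

def ReachableIn (r : α → α → Prop) (P : α → Prop) : ℕ → α → Prop
  | 0, a => P a
  | T + 1, a => ∃ a', r a a' ∧ ReachableIn r P T a'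

/-- If the target `P` can be reached at all, then it is reached by a memoryless rule. -/
theorem ReachableIn.exists_iterate {T₀ : ℕ} {a₀ : α} (h₀ : ReachableIn r P T₀ a₀) :
    ∃ (ρ : α → α) (T : ℕ), (∀ s < T, r (ρ^[s] a₀) (ρ^[s + 1] a₀)) ∧ P (ρ^[T] a₀) := by
  classical
  -- `D` is the distance to the target and `ρ` lowers it by one, so `ρ` needs no memory of the path.
  let D : α → ℕ := fun a => sInf {T | ReachableIn r P T a}
  let ρ : α → α := fun a =>
    if h : ∃ a', r a a' ∧ ReachableIn r P (D a - 1) a' then h.choose else a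
  have key : ∀ T a, ReachableIn r P T a → D a = T →
      (∀ s < T, r (ρ^[s] a) (ρ^[s + 1] a)) ∧ P (ρ^[T] a) := by
    intro T
    induction T with
    | zero => exact fun a ha _ => ⟨fun s hs => absurd hs (Nat.not_lt_zero s), ha⟩
    | succ T ih =>
      intro a ha hD
      have hex : ∃ a', r a a' ∧ ReachableIn r P (D a - 1) a' := by
        rw [hD]
        exact ha
      have hρ : ρ a = hex.choose := dif_pos hex
      obtain ⟨h1, h2⟩ := hex.choose_spec
      rw [← hρ] at h1 h2
      rw [hD, Nat.add_sub_cancel] at h2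
      have hD' : D (ρ a) = T := by
        refine le_antisymm (Nat.sInf_le h2) ?_
        have hmem : ReachableIn r P (D (ρ a)) (ρ a) :=
          Nat.sInf_mem (s := {T | ReachableIn r P T (ρ a)}) ⟨T, h2⟩
        have : D a ≤ D (ρ a) + 1 := Nat.sInf_le ⟨ρ a, h1, hmem⟩
        omega
      obtain ⟨hrun, hend⟩ := ih (ρ a) h2 hD'
      refine ⟨fun s hs => ?_, hend⟩
      cases s with
      | zero => exact h1
      | succ s => exact hrun s (by omega)
  have hmem : ReachableIn r P (D a₀) a₀ :=
    Nat.sInf_mem (s := {T | ReachableIn r P T a₀}) ⟨T₀, h₀⟩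
  exact ⟨ρ, D a₀, key _ a₀ hmem rfl⟩

end

/-- `y` is the infinitesimal part of the basic solution of `B` for the right-hand side perturbed
infinitesimally in direction `δ`, and the perturbed basic solution is feasible. -/
structure IsPerturbedSolution {m n : ℕ} (A : Matrix (Fin m) (Fin n) ℤ) (b : Fin m → ℤ)
    (δ : Fin m → ℝ) (B : Finset (Fin m)) (x y : Fin n → ℝ) : Prop where
  eq : ∀ i ∈ B, realRow A i ⬝ᵥ y = δ i
  le : ∀ l, realRow A l ⬝ᵥ x = b l → realRow A l ⬝ᵥ y ≤ δ l

/-- A perturbation for which no basis is degenerate. -/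
def IsGenericPerturbation {m n : ℕ} (A : Matrix (Fin m) (Fin n) ℤ) (δ : Fin m → ℝ) : Prop :=
  ∀ B : Finset (Fin m), LinearIndependent ℝ (fun i : B => realRow A i) → B.card = n →
    ∀ y, (∀ i ∈ B, realRow A i ⬝ᵥ y = δ i) → ∀ l ∉ B, realRow A l ⬝ᵥ y ≠ δ l

/-! ### Generic perturbations and termination. -/

section

variable {m n k : ℕ} {A : Matrix (Fin m) (Fin n) ℤ} {b : Fin m → ℤ}

open Polynomial in
-- Perturb row `i` by `t ^ i` outside `B` and by 0 on `B`. Expanding row `l` in the basis `B'` turns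
-- degeneracy into a polynomial equation for `t`.
theorem exists_polynomial_of_degenerate {B : Finset (Fin m)}
    (hB : LinearIndependent ℝ (fun i : B => realRow A i)) {B' : Finset (Fin m)}
    (hB' : LinearIndependent ℝ (fun i : B' => realRow A i)) (hcard' : B'.card = n)
    {l : Fin m} (hl : l ∉ B') :
    ∃ p : ℝ[X], p ≠ 0 ∧ ∀ (t : ℝ) (y : Fin n → ℝ),
      (∀ i ∈ B', realRow A i ⬝ᵥ y = if i ∈ B then 0 else t ^ (i : ℕ)) →
      (realRow A l ⬝ᵥ y = if l ∈ B then 0 else t ^ (l : ℕ)) → p.eval t = 0 := by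
  classical
  obtain ⟨μ, hμ⟩ : ∃ μ : Fin m → ℝ, realRow A l = ∑ i ∈ B', μ i • realRow A i := by
    have hmem : realRow A l ∈ Submodule.span ℝ (Set.range fun i : B' => realRow A i) := by
      rw [span_realRow_eq_top hB' hcard']
      exact Submodule.mem_top
    obtain ⟨f, hf⟩ := (Submodule.mem_span_range_iff_exists_fun ℝ).1 hmem
    refine ⟨fun i => if h : i ∈ B' then f ⟨i, h⟩ else 0, ?_⟩
    rw [← hf, ← Finset.sum_coe_sort B']
    exact Finset.sum_congr rfl fun i _ => by simp
  have hdot : ∀ z, realRow A l ⬝ᵥ z = ∑ i ∈ B', μ i * realRow A i ⬝ᵥ z := fun z => by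
    rw [hμ, sum_dotProduct]
    exact Finset.sum_congr rfl fun i _ => by rw [smul_dotProduct, smul_eq_mul]
  let p : ℝ[X] := ∑ i ∈ B', (if i ∈ B then 0 else monomial (i : ℕ) (μ i)) -
    if l ∈ B then 0 else monomial (l : ℕ) 1
  refine ⟨p, fun hp => ?_, fun t y hy hly => ?_⟩
  · have hcoeff : ∀ e : Fin m, p.coeff e =
        (if e ∈ B' ∧ e ∉ B then μ e else 0) - if l = e ∧ l ∉ B then 1 else 0 := by
      intro e
      simp only [p, coeff_sub, finsetSum_coeff]
      congr 1
      · have hterm : ∀ i : Fin m, (if i ∈ B then (0 : ℝ[X]) else monomial (i : ℕ) (μ i)).coeff e =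
            if i = e then (if e ∈ B then 0 else μ e) else 0 := by
          intro i
          by_cases hie : i = e
          · subst hie
            by_cases h : i ∈ B <;> simp [h]
          · have hie' : (i : ℕ) ≠ e := fun h => hie (Fin.ext h)
            by_cases h : i ∈ B <;> simp [h, hie, hie', coeff_monomial]
        rw [Finset.sum_congr rfl fun i _ => hterm i, Finset.sum_ite_eq']
        by_cases h1 : e ∈ B' <;> by_cases h2 : e ∈ B <;> simp [h1, h2]
      · by_cases h : l ∈ B <;> simp [h, coeff_monomial, Fin.ext_iff]
    -- If `l ∈ B` and `p = 0`, row `l` is a combination of other rows of `B`, which its basic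
    -- direction refutes; if `l ∉ B`, the coefficient of `p` at `l` is `-1`.
    by_cases hlB : l ∈ B
    · obtain ⟨z, hz⟩ := exists_isBasicDirection hB hlB
      have h1 := hdot z
      rw [hz.2.1, Finset.sum_eq_zero fun i hi => ?_] at h1
      · norm_num at h1
      · by_cases hiB : i ∈ B
        · rw [hz.2.2 i hiB fun h => hl (h ▸ hi), mul_zero]
        · have := hcoeff i
          rw [hp, coeff_zero, if_pos ⟨hi, hiB⟩, if_neg fun h => h.2 hlB, sub_zero] at this
          rw [← this, zero_mul]
    · have := hcoeff l
      rw [hp, coeff_zero, if_neg fun h => hl h.1, if_pos ⟨rfl, hlB⟩] at this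
      norm_num at this
  · have h1 := hdot y
    rw [hly, Finset.sum_congr rfl fun i hi => by rw [hy i hi]] at h1
    simp only [p, eval_sub, eval_finsetSum]
    rw [sub_eq_zero]
    convert h1.symm using 1
    · exact Finset.sum_congr rfl fun i _ => by split_ifs <;> simp
    · split_ifs <;> simp

theorem exists_isGenericPerturbation {B : Finset (Fin m)}
    (hB : LinearIndependent ℝ (fun i : B => realRow A i)) :
    ∃ δ : Fin m → ℝ, (∀ i ∈ B, δ i = 0) ∧ (∀ i, 0 ≤ δ i) ∧ IsGenericPerturbation A δ := by
  classical
  have hp : ∀ q : Finset (Fin m) × Fin m, ∃ p : Polynomial ℝ, p ≠ 0 ∧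
      (LinearIndependent ℝ (fun i : q.1 => realRow A i) → q.1.card = n → q.2 ∉ q.1 →
        ∀ (t : ℝ) (y : Fin n → ℝ),
        (∀ i ∈ q.1, realRow A i ⬝ᵥ y = if i ∈ B then 0 else t ^ (i : ℕ)) →
        (realRow A q.2 ⬝ᵥ y = if q.2 ∈ B then 0 else t ^ (q.2 : ℕ)) → p.eval t = 0) := by
    intro q
    by_cases h : LinearIndependent ℝ (fun i : q.1 => realRow A i) ∧ q.1.card = n ∧ q.2 ∉ q.1
    · obtain ⟨p, hp0, hp⟩ := exists_polynomial_of_degenerate hB h.1 h.2.1 h.2.2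
      exact ⟨p, hp0, fun _ _ _ => hp⟩
    · exact ⟨1, one_ne_zero, fun h1 h2 h3 => absurd ⟨h1, h2, h3⟩ h⟩
  choose p hp0 hp using hp
  have hprod : ∏ q, p q ≠ 0 := Finset.prod_ne_zero_iff.2 fun q _ => hp0 q
  -- One positive `t` avoids the roots for all of the finitely many pairs of a basis and a row.
  obtain ⟨t, ht, hroot⟩ :=
    (Set.Ioi_infinite (0 : ℝ)).exists_notMem_finset (∏ q, p q).roots.toFinset
  rw [Multiset.mem_toFinset, Polynomial.mem_roots hprod, Polynomial.IsRoot,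
    Polynomial.eval_prod, Finset.prod_eq_zero_iff] at hroot
  refine ⟨fun i => if i ∈ B then 0 else t ^ (i : ℕ), fun i hi => if_pos hi, fun i => ?_,
    fun B' hB' hcard' y hy l hl hly =>
      hroot ⟨(B', l), Finset.mem_univ _, hp (B', l) hB' hcard' hl t y hy hly⟩⟩
  dsimp only
  split_ifs
  exacts [le_rfl, pow_nonneg (le_of_lt ht) _]

/-- With the lexicographic ratio test, every pivot increases the perturbed value of `w`. -/
theorem IsShadowBasis.exists_lex_pivot
    (hbd : ∀ x ∈ polyhedron A b, ∀ j, 0 ≤ x j ∧ x j ≤ (k : ℝ)) {c w : Fin n → ℝ}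
    {S : Finset (Fin m) × (Fin n → ℝ)} (hS : IsShadowBasis A b c w S)
    (hopt : ¬ IsOptimalBasis A c S.1) {δ : Fin m → ℝ} (hδ : IsGenericPerturbation A δ)
    {y : Fin n → ℝ} (hy : IsPerturbedSolution A b δ S.1 S.2 y) :
    ∃ S' y', IsShadowPivot A b c w S S' ∧ IsPerturbedSolution A b δ S'.1 S'.2 y' ∧
      toLex (w ⬝ᵥ S.2, w ⬝ᵥ y) < toLex (w ⬝ᵥ S'.2, w ⬝ᵥ y') := by
  classical
  obtain ⟨i, z, hz⟩ := hS.exists_isShadowDirection hopt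
  have hB := hS.tightBasis
  have hz0 : z ≠ 0 := by
    rintro rfl
    simpa using hz.pos
  -- This is the ratio test for the right-hand side `b + ε δ` with `ε` infinitesimal.
  obtain ⟨j, hj, hlex⟩ := Finset.exists_min_image
    (Finset.univ.filter fun j => 0 < realRow A j ⬝ᵥ z)
    (fun l => toLex (((b l : ℝ) - realRow A l ⬝ᵥ S.2) / (realRow A l ⬝ᵥ z),
      (δ l - realRow A l ⬝ᵥ y) / (realRow A l ⬝ᵥ z)))
    ((exists_realRow_dotProduct_pos hbd hB.feasible hz0).imp fun j hj => by simpa using hj)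
  simp only [Finset.mem_filter, Finset.mem_univ, true_and, Prod.Lex.toLex_le_toLex] at hj hlex
  set t := ((b j : ℝ) - realRow A j ⬝ᵥ S.2) / (realRow A j ⬝ᵥ z) with ht
  set s := (δ j - realRow A j ⬝ᵥ y) / (realRow A j ⬝ᵥ z) with hs
  have hmin : ∀ l, 0 < realRow A l ⬝ᵥ z →
      t ≤ ((b l : ℝ) - realRow A l ⬝ᵥ S.2) / (realRow A l ⬝ᵥ z) :=
    fun l hl => (hlex l hl).elim le_of_lt fun h => h.1.le
  have ht0 : 0 ≤ t := (ratio_test hB.feasible hj hmin).1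
  have hjB : j ∉ S.1 := by
    intro hjB
    by_cases hji : j = i
    · rw [hji, hz.basic.2.1] at hj
      linarith
    · rw [hz.basic.2.2 j hjB hji] at hj
      exact lt_irrefl _ hj
  -- In a degenerate pivot row `j` is already tight, and genericity makes its infinitesimal slack
  -- strictly positive.
  have hs0 : t = 0 → 0 < s := by
    intro h
    have hjt : realRow A j ⬝ᵥ S.2 = b j := by
      rcases div_eq_zero_iff.1 (ht ▸ h) with h | h
      · linarith
      · exact absurd h hj.ne'
    exact div_pos (sub_pos.2 (lt_of_le_of_ne (hy.le j hjt)
      (hδ S.1 hB.indep hB.card_eq y hy.eq j hjB))) hj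
  have hadd : ∀ (v p : Fin n → ℝ) (τ : ℝ), v ⬝ᵥ (p + τ • z) = v ⬝ᵥ p + τ * v ⬝ᵥ z :=
    fun v p τ => by rw [dotProduct_add, dotProduct_smul, smul_eq_mul]
  refine ⟨(insert j (S.1.erase i), S.2 + t • z), y + s • z,
    ⟨i, z, ⟨hz.basic, hz.improves, j, hj, hmin, rfl, rfl⟩, hz.pos, hz.slope_le⟩,
    ⟨fun l hl => ?_, fun l hl => ?_⟩, ?_⟩
  · rw [hadd]
    rcases Finset.mem_insert.1 hl with rfl | hl
    · rw [hs, div_mul_cancel₀ _ hj.ne']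
      ring
    · have hl := Finset.mem_erase.1 hl
      rw [hz.basic.2.2 l hl.2 hl.1, mul_zero, add_zero, hy.eq l hl.2]
  · rw [hadd] at hl ⊢
    -- A decreasing row can be tight at the new point only if `t = 0`; an increasing one ties with
    -- `j` in the first ratio, so the second ratio decides.
    rcases lt_trichotomy (realRow A l ⬝ᵥ z) 0 with hneg | hzero | hpos
    · have ht' : t = 0 := by
        by_contra hne
        have := mul_neg_of_pos_of_neg (lt_of_le_of_ne ht0 (Ne.symm hne)) hneg
        have hl' := hB.feasible l
        linarith
      rw [ht', zero_mul, add_zero] at hl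
      linarith [hy.le l hl, mul_neg_of_pos_of_neg (hs0 ht') hneg]
    · rw [hzero, mul_zero, add_zero] at hl ⊢
      exact hy.le l hl
    · have hteq : ((b l : ℝ) - realRow A l ⬝ᵥ S.2) / (realRow A l ⬝ᵥ z) = t := by
        rw [div_eq_iff hpos.ne']
        linarith
      have := ((hlex l hpos).resolve_left (by rw [hteq]; exact lt_irrefl _)).2
      have := (le_div_iff₀ hpos).1 this
      linarith
  · rw [Prod.Lex.toLex_lt_toLex]
    simp only [hadd]
    rcases ht0.lt_or_eq with h | h
    · exact Or.inl (lt_add_of_pos_right _ (mul_pos h hz.pos))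
    · exact Or.inr ⟨by rw [← h, zero_mul, add_zero],
        lt_add_of_pos_right _ (mul_pos (hs0 h.symm) hz.pos)⟩

theorem IsShadowBasis.exists_reachableIn
    (hbd : ∀ x ∈ polyhedron A b, ∀ j, 0 ≤ x j ∧ x j ≤ (k : ℝ)) {c w : Fin n → ℝ}
    {δ : Fin m → ℝ} (hδ : IsGenericPerturbation A δ) {S : Finset (Fin m) × (Fin n → ℝ)}
    (hS : IsShadowBasis A b c w S) {y : Fin n → ℝ}
    (hy : IsPerturbedSolution A b δ S.1 S.2 y) :
    ∃ T, ReachableIn (fun S S' => ¬ IsOptimalBasis A c S.1 ∧ IsShadowPivot A b c w S S')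
      (fun S => IsOptimalBasis A c S.1) T S := by
  classical
  -- A basis determines both parts of its solution, so the finite set of bases above the current
  -- value loses the new basis at each pivot.
  let better : ℝ ×ₗ ℝ → Finset (Finset (Fin m)) := fun q => Finset.univ.filter fun B =>
    ∃ x y, IsTightBasis A b B x ∧ (∀ i ∈ B, realRow A i ⬝ᵥ y = δ i) ∧
      q < toLex (w ⬝ᵥ x, w ⬝ᵥ y)
  induction hN : (better (toLex (w ⬝ᵥ S.2, w ⬝ᵥ y))).card using Nat.strong_induction_on
    generalizing S y with
  | _ N ih =>
  by_cases hopt : IsOptimalBasis A c S.1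
  · exact ⟨0, hopt⟩
  obtain ⟨S', y', hpiv, hy', hlt⟩ := hS.exists_lex_pivot hbd hopt hδ hy
  have hS' := hS.pivot hpiv
  have hsub : better (toLex (w ⬝ᵥ S'.2, w ⬝ᵥ y')) ⊂ better (toLex (w ⬝ᵥ S.2, w ⬝ᵥ y)) := by
    refine (Finset.ssubset_iff_of_subset fun B hB => ?_).2 ⟨S'.1, ?_, fun hmem => ?_⟩
    · simp only [better, Finset.mem_filter, Finset.mem_univ, true_and] at hB ⊢
      obtain ⟨x, y, h1, h2, h3⟩ := hB
      exact ⟨x, y, h1, h2, hlt.trans h3⟩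
    · simp only [better, Finset.mem_filter, Finset.mem_univ, true_and]
      exact ⟨S'.2, y', hS'.tightBasis, hy'.eq, hlt⟩
    · simp only [better, Finset.mem_filter, Finset.mem_univ, true_and] at hmem
      obtain ⟨x₁, y₁, h1, h2, h3⟩ := hmem
      have hx : x₁ - S'.2 = 0 := eq_zero_of_realRow_dotProduct_eq_zero h1.indep h1.card_eq
        fun i hi => by rw [dotProduct_sub, h1.tight i hi, hS'.tightBasis.tight i hi, sub_self]
      have hy₁ : y₁ - y' = 0 := eq_zero_of_realRow_dotProduct_eq_zero h1.indep h1.card_eq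
        fun i hi => by rw [dotProduct_sub, h2 i hi, hy'.eq i hi, sub_self]
      rw [sub_eq_zero.1 hx, sub_eq_zero.1 hy₁] at h3
      exact lt_irrefl _ h3
  obtain ⟨T, hT⟩ := ih _ (hN ▸ Finset.card_lt_card hsub) hS' hy' rfl
  exact ⟨T + 1, S', ⟨hopt, hpiv⟩, hT⟩

theorem IsTightBasis.exists_terminating_rule
    (hbd : ∀ x ∈ polyhedron A b, ∀ j, 0 ≤ x j ∧ x j ≤ (k : ℝ)) {B : Finset (Fin m)}
    {x : Fin n → ℝ} (hB : IsTightBasis A b B x) (c : Fin n → ℝ) :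
    ∃ (ρ : Finset (Fin m) × (Fin n → ℝ) → Finset (Fin m) × (Fin n → ℝ)) (T : ℕ),
      IsSimplexRun A b c (auxVector A B) T (fun s => ρ^[s] (B, x)) ∧
      IsOptimalBasis A c (ρ^[T] (B, x)).1 := by
  obtain ⟨δ, hδB, hδ0, hδ⟩ := exists_isGenericPerturbation hB.indep
  obtain ⟨T, hT⟩ := (hB.isShadowBasis c).exists_reachableIn hbd hδ (y := 0)
    ⟨fun i hi => by rw [dotProduct_zero, hδB i hi], fun l _ => by
      rw [dotProduct_zero]; exact hδ0 l⟩
  exact hT.exists_iterate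

end

/-! ### The monotone diameter -/

theorem monotoneDiameter_le {n N : ℕ} {P : Set (Fin n → ℝ)}
    (h : ∀ c : Fin n → ℝ, ∀ v ∈ P.extremePoints ℝ, ∃ L ≤ N, ∃ p : ℕ → Fin n → ℝ,
      p 0 = v ∧ IsMonotonePath P c L p ∧ IsOptimal P c (p L)) :
    monotoneDiameter P ≤ (N : ℕ∞) := by
  refine iSup₂_le fun c _ => iSup₂_le fun v hv => ?_
  obtain ⟨L, hL, hp⟩ := h c v hv
  exact iInf₂_le_of_le L hp (Nat.cast_le.2 hL)

/-! ### Projections that preserve the dimension. -/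

section Projection

variable {n d k : ℕ} {P : Set (Fin n → ℝ)} {P' : Set (Fin d → ℝ)}
  {π : (Fin n → ℝ) →ₗ[ℝ] (Fin d → ℝ)} {σ : (Fin d → ℝ) →ᵃ[ℝ] (Fin n → ℝ)}

theorem mem_extremePoints_map_of_leftInverse (hπ : π '' P = P') (hσ : ∀ x ∈ P, σ (π x) = x)
    {v : Fin n → ℝ} (hv : v ∈ P.extremePoints ℝ) : π v ∈ P'.extremePoints ℝ := by
  subst hπ
  rw [mem_extremePoints] at hv ⊢
  refine ⟨⟨v, hv.1, rfl⟩, ?_⟩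
  rintro _ ⟨x, hx, rfl⟩ _ ⟨y, hy, rfl⟩ hmem
  have h : σ (π v) ∈ openSegment ℝ (σ (π x)) (σ (π y)) := by
    rw [← image_openSegment]
    exact ⟨_, hmem, rfl⟩
  rw [hσ v hv.1, hσ x hx, hσ y hy] at h
  obtain ⟨h1, h2⟩ := hv.2 x hx y hy h
  exact ⟨by rw [h1], by rw [h2]⟩

theorem map_mem_openSegment {p q r : Fin n → ℝ} (h : r ∈ openSegment ℝ p q) :
    π r ∈ openSegment ℝ (π p) (π q) := by
  obtain ⟨s, t, hs, ht, hst, rfl⟩ := h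
  exact ⟨s, t, hs, ht, hst, by simp⟩

theorem Neighbor.map_of_leftInverse (hP : Convex ℝ P) (hπ : π '' P = P')
    (hσ : ∀ x ∈ P, σ (π x) = x) {u v : Fin d → ℝ} (h : Neighbor P' u v) :
    Neighbor P (σ u) (σ v) := by
  subst hπ
  have hext : ∀ y ∈ (π '' P).extremePoints ℝ, σ y ∈ P.extremePoints ℝ := by
    intro y hy
    rw [mem_extremePoints] at hy ⊢
    obtain ⟨⟨x, hx, rfl⟩, hy⟩ := hy
    rw [hσ x hx]
    refine ⟨hx, fun p hp q hq hmem => ?_⟩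
    obtain ⟨h1, h2⟩ := hy _ ⟨p, hp, rfl⟩ _ ⟨q, hq, rfl⟩ (map_mem_openSegment hmem)
    rw [← hσ p hp, ← hσ q hq, h1, h2, hσ x hx]
    exact ⟨rfl, rfl⟩
  obtain ⟨hu, hv, hne, hseg⟩ := h
  have hπσ : ∀ y ∈ π '' P, π (σ y) = y := by
    rintro _ ⟨x, hx, rfl⟩
    rw [hσ x hx]
  refine ⟨hext u hu, hext v hv, fun h => hne ?_, hP.segment_subset (hext u hu).1 (hext v hv).1,
    fun p hp q hq r hr hmem => ?_⟩
  · rw [← hπσ u hu.1, h, hπσ v hv.1]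
  · have hr' : π r ∈ segment ℝ u v := by
      obtain ⟨s, t, hs, ht, hst, rfl⟩ := hr
      exact ⟨s, t, hs, ht, hst, by rw [map_add, map_smul, map_smul, hπσ u hu.1, hπσ v hv.1]⟩
    rw [← hσ p hp, ← image_segment]
    exact ⟨_, hseg.left_mem_of_mem_openSegment ⟨p, hp, rfl⟩ ⟨q, hq, rfl⟩ hr'
      (map_mem_openSegment hmem), rfl⟩

/-- A projection that does not lower the dimension is inverted on `P` by an affine map. -/
theorem exists_affine_leftInverse (hP : polyDim P = d) (hP' : polyDim (π '' P) = d) :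
    ∃ σ : (Fin d → ℝ) →ᵃ[ℝ] (Fin n → ℝ), ∀ x ∈ P, σ (π x) = x := by
  rcases P.eq_empty_or_nonempty with rfl | ⟨p, hp⟩
  · exact ⟨AffineMap.const ℝ _ 0, fun x hx => absurd hx (Set.notMem_empty x)⟩
  have hmap : (vectorSpan ℝ P).map π = vectorSpan ℝ (π '' P) :=
    AffineMap.map_vectorSpan (f := π.toAffineMap)
  -- Equal dimensions make `π` injective on the direction space of `P`; `σ` inverts it there and is
  -- translated to fix the base point `p`.
  have hinj : LinearMap.ker (π.domRestrict (vectorSpan ℝ P)) = ⊥ := by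
    have h := LinearMap.finrank_range_add_finrank_ker (π.domRestrict (vectorSpan ℝ P))
    rw [LinearMap.range_domRestrict, hmap] at h
    unfold polyDim at hP hP'
    exact Submodule.finrank_eq_zero.1 (by omega)
  obtain ⟨g, hg⟩ := LinearMap.exists_leftInverse_of_injective _ hinj
  refine ⟨((vectorSpan ℝ P).subtype ∘ₗ g).toAffineMap +
    AffineMap.const ℝ _ (p - (vectorSpan ℝ P).subtype (g (π p))), fun x hx => ?_⟩
  have h1 : g (π (x - p)) = (⟨x - p, vsub_mem_vectorSpan ℝ hx hp⟩ : vectorSpan ℝ P) :=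
    LinearMap.congr_fun hg ⟨x - p, vsub_mem_vectorSpan ℝ hx hp⟩
  have h2 : ((g (π x) : vectorSpan ℝ P) : Fin n → ℝ) - g (π p) = x - p := by
    rw [← Submodule.coe_sub, ← map_sub, ← map_sub, h1]
  change ((g (π x) : vectorSpan ℝ P) : Fin n → ℝ) + (p - g (π p)) = x
  rw [add_sub_left_comm, h2]
  abel

/-- The objective is pulled back along the linear part of `σ`, which preserves differences of
values; monotone paths in `P'` then lift through `σ`. -/
theorem monotoneDiameter_le_of_projection {N : ℕ} (hP : Convex ℝ P) (hπ : π '' P = P')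
    (hdim : polyDim P = d) (hdim' : polyDim P' = d)
    (h : ∀ c : Fin d → ℝ, ∀ v ∈ P'.extremePoints ℝ, ∃ L ≤ N, ∃ p : ℕ → Fin d → ℝ,
      p 0 = v ∧ IsMonotonePath P' c L p ∧ IsOptimal P' c (p L)) :
    monotoneDiameter P ≤ (N : ℕ∞) := by
  obtain ⟨σ, hσ⟩ := exists_affine_leftInverse (π := π) hdim (hπ ▸ hdim')
  refine monotoneDiameter_le fun c v hv => ?_
  have hc : ∀ y y' : Fin d → ℝ, c ⬝ᵥ σ y - c ⬝ᵥ σ y' =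
      (c ᵥ* LinearMap.toMatrix' σ.linear) ⬝ᵥ y - (c ᵥ* LinearMap.toMatrix' σ.linear) ⬝ᵥ y' := by
    intro y y'
    rw [← Matrix.dotProduct_mulVec, ← Matrix.dotProduct_mulVec, LinearMap.toMatrix'_mulVec,
      LinearMap.toMatrix'_mulVec, ← dotProduct_sub, ← dotProduct_sub, ← map_sub σ.linear]
    exact congrArg _ (σ.linearMap_vsub y y').symm
  obtain ⟨L, hL, p, hp0, hpath, hopt⟩ := h (c ᵥ* LinearMap.toMatrix' σ.linear) (π v)
    (mem_extremePoints_map_of_leftInverse hπ hσ hv)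
  refine ⟨L, hL, fun s => σ (p s), by simp only [hp0, hσ v hv.1], fun s hs => ?_, ?_, fun x hx => ?_⟩
  · refine ⟨(hpath s hs).1.map_of_leftInverse hP hπ hσ, ?_⟩
    linarith [hc (p s) (p (s + 1)), (hpath s hs).2]
  · have hmem := hopt.1
    rw [← hπ] at hmem
    obtain ⟨x, hx, hxp⟩ := hmem
    simpa only [← hxp, hσ x hx] using hx
  · have h1 := hc (π x) (p L)
    rw [hσ x hx] at h1
    linarith [hopt.2 (π x) (hπ ▸ ⟨x, hx, rfl⟩)]

theorem IsLatticePolytope.image_funLeft (hP : IsLatticePolytope k P) (I : Fin d → Fin n) :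
    IsLatticePolytope k (LinearMap.funLeft ℝ ℝ I '' P) := by
  classical
  obtain ⟨⟨V, hV⟩, hbd⟩ := hP
  refine ⟨⟨V.image fun v i => v (I i), ?_⟩, ?_⟩
  · rw [hV, LinearMap.image_convexHull, Finset.coe_image, Set.image_image, Set.image_image]
    rfl
  · rintro _ ⟨x, hx, rfl⟩ j
    exact hbd x hx (I j)

end Projection

theorem theorem1p4 (m n d k : ℕ) (A : Matrix (Fin m) (Fin n) ℤ) (b : Fin m → ℤ)
    (hP : IsLatticePolytope k (polyhedron A b)) (hd : polyDim (polyhedron A b) = d) :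
    -- the lattice shadow rule, for every objective and every initial vertex
    (∀ (c x₀ : Fin n → ℝ), x₀ ∈ (polyhedron A b).extremePoints ℝ →
      (∃ B, IsLatticeStart A b B x₀) ∧
      ∀ B, IsLatticeStart A b B x₀ →
        -- edge-pivot rule: every run is short and monotone, and stops only at an optimum
        (∀ (T : ℕ) (x : ℕ → Fin n → ℝ), x 0 = x₀ →
          IsShadowRun (polyhedron A b) c (auxVector A B) T x →
            T ≤ d * n * k * entryNorm A ∧
            IsMonotonePath (polyhedron A b) c T x ∧
            (IsOptimal (polyhedron A b) c (x T) ∨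
              ∃ u, IsShadowStep (polyhedron A b) c (auxVector A B) (x T) u)) ∧
        -- Simplex method: every run makes few non-degenerate steps, these are steps of the
        -- edge-pivot rule, and the run stops only at an optimum
        (∀ (T : ℕ) (S : ℕ → Finset (Fin m) × (Fin n → ℝ)), S 0 = (B, x₀) →
          IsSimplexRun A b c (auxVector A B) T S →
            nondegenerateSteps T S ≤ d * n * k * entryNorm A ∧
            (∀ s ≤ T, IsTightBasis A b (S s).1 (S s).2) ∧
            (∀ s < T, (S (s + 1)).2 ≠ (S s).2 →
              IsShadowStep (polyhedron A b) c (auxVector A B) (S s).2 (S (s + 1)).2) ∧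
            (IsOptimalBasis A c (S T).1 → IsOptimal (polyhedron A b) c (S T).2) ∧
            (¬ IsOptimalBasis A c (S T).1 →
              ∃ S', IsShadowPivot A b c (auxVector A B) (S T) S')) ∧
        -- ties can be broken by a rule that avoids cycling, so that an optimum is reached
        (∃ (ρ : Finset (Fin m) × (Fin n → ℝ) → Finset (Fin m) × (Fin n → ℝ)) (T : ℕ),
          IsSimplexRun A b c (auxVector A B) T (fun s => ρ^[s] (B, x₀)) ∧
          IsOptimalBasis A c (ρ^[T] (B, x₀)).1)) ∧
    -- the monotone diameter
    monotoneDiameter (polyhedron A b) ≤ ((d * n * k * entryNorm A : ℕ) : ℕ∞) ∧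
    (n = d → monotoneDiameter (polyhedron A b) ≤ ((d ^ 2 * k * entryNorm A : ℕ) : ℕ∞)) ∧
    -- the same bound after a coordinate projection onto a full-dimensional polytope
    (∀ (I : Fin d ↪ Fin n) (m' : ℕ) (A' : Matrix (Fin m') (Fin d) ℤ) (b' : Fin m' → ℤ),
      (fun (x : Fin n → ℝ) (i : Fin d) => x (I i)) '' polyhedron A b = polyhedron A' b' →
      polyDim (polyhedron A' b') = d →
      monotoneDiameter (polyhedron A b) ≤ ((d ^ 2 * k * entryNorm A' : ℕ) : ℕ∞)) := by
  subst hd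
  refine ⟨fun c x₀ hx₀ => ⟨exists_isLatticeStart hx₀, fun B hB => ⟨?_, ?_, ?_⟩⟩, ?_, ?_, ?_⟩
  · rintro T x rfl hrun
    have hpar := hB.1.isParametricOptimal c
    refine ⟨hrun.length_le hP hB hx₀, hrun.isMonotonePath hP.2 hx₀ hpar, ?_⟩
    have hinv := hrun.invariants hP.2 hx₀ hpar le_rfl
    exact or_iff_not_imp_left.2 fun hopt => exists_isShadowStep hP hinv.1 hinv.2 hopt
  · intro T S hS hrun
    have hinv := fun s hs =>
      hrun.isShadowBasis (by rw [hS]; exact hB.1.isShadowBasis c) (s := s) hs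
    exact ⟨hrun.nondegenerateSteps_le hP hB hS, fun s hs => (hinv s hs).tightBasis,
      fun s hs hne => (hrun s hs).2.isShadowStep (hinv s hs.le) hne,
      isOptimal_of_forall_isBasicDirection (hinv T le_rfl).tightBasis,
      (hinv T le_rfl).exists_isShadowPivot hP.2⟩
  · exact hB.1.exists_terminating_rule hP.2 c
  · exact monotoneDiameter_le fun c v hv => exists_short_monotonePath hP c hv
  · intro hn
    rw [pow_two]
    nth_rewrite 2 [← hn]
    exact monotoneDiameter_le fun c v hv => exists_short_monotonePath hP c hv
  · intro I m' A' b' himage hdim'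
    have hP' : IsLatticePolytope k (polyhedron A' b') := himage ▸ hP.image_funLeft I
    refine monotoneDiameter_le_of_projection (π := LinearMap.funLeft ℝ ℝ I) convex_polyhedron
      himage rfl hdim' fun c v hv => ?_
    -- The projected polytope lies in dimension `d`, so the factor `n` of the bound becomes `d`.
    obtain ⟨L, hL, hp⟩ := exists_short_monotonePath hP' c hv
    rw [hdim', ← pow_two] at hL
    exact ⟨L, hL, hp⟩
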